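/- Let $F_2=\langle u,v\rangle$ be the free group of rank two, let $\rho:\mathrm{Aut}(F_2)\to GL(2,\mathbb Z)$ be the homomorphism induced by the abelianization $F_2\to\mathbb Z^2$, $u\mapsto e_1$, $v\mapsto e_2$ (so the columns of $\rho(\gamma)$ are the abelianized images of $\gamma(u)$ and $\gamma(v)$), and let $\mathrm{Aut}^+(F_2)=\rho^{-1}(SL(2,\mathbb Z))$. Define $\sigma,\iota,\zeta\in\mathrm{Aut}^+(F_2)$ by $$\sigma:(u,v)\mapsto(u^{-1},v^{-1}),\qquad \iota:(u,v)\mapsto(v,u^{-1}),\qquad \zeta:(u,v)\mapsto(v,v^{-1}u^{-1}),$$ and put $$A=\begin{pmatrix}1&-1\\0&1\end{pmatrix},\quad B=\begin{pmatrix}1&0\\1&1\end{pmatrix},\quad S=\begin{pmatrix}0&-1\\1&0\end{pmatrix},\quad M=BA.$$ (i) The orders of the nontrivial torsion elements of $SL(2,\mathbb Z)$ are exactly $6,4,3,2$. In $SL(2,\mathbb Z)$, the elements of order $2$ form a single conjugacy class, and the elements of each of the orders $6$, $4$, $3$ form exactly two conjugacy classes. Representatives are $M$ and $M^{-1}$ for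 order $6$; $S$ and $S^{-1}$ for order $4$; $M^2$ and $M^{-2}$ for order $3$; $-I$ for order $2$. Here $$M=\begin{pmatrix}1&-1\\1&0\end{pmatrix},\quad M^{-1}=\begin{pmatrix}0&1\\-1&1\end{pmatrix},\quad M^{2}=\begin{pmatrix}0&-1\\1&-1\end{pmatrix},\quad M^{-2}=\begin{pmatrix}-1&1\\-1&0\end{pmatrix}.$$ (ii) Let $g\in SL(2,\mathbb Z)$ have order $k\in\{2,4,3\}$ and let $\gamma\in\mathrm{Aut}^+(F_2)$ be a lift of $g$ (that is, $\rho(\gamma)=g$) which also has order $k$. Then $\gamma$ is conjugate in $\mathrm{Aut}^+(F_2)$ to $\sigma$ if $k=2$; to $\iota$ or $\iota^{-1}$ if $k=4$; and to $\zeta$ or $\zeta^{-1}$ if $k=3$. (iii) $\mathrm{Aut}^+(F_2)$ has no element of order $6$. -/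

import Mathlib

namespace TorsionAutFTwo

open Matrix

/-- The free group of rank two. -/
abbrev F2 : Type := FreeGroup (Fin 2)

/-- The first free generator. -/
def u : F2 := FreeGroup.of 0

/-- The second free generator. -/
def v : F2 := FreeGroup.of 1

/-- The special linear group of two by two integer matrices. -/
abbrev SL2Z : Type := Matrix.SpecialLinearGroup (Fin 2) ℤ

/-! ### The abelianization map on automorphisms -/

/-- The abelianization map from the free group onto the lattice, sending the first generator to
the first basis vector and the second generator to the second basis vector. -/
def ab : F2 →* Multiplicative (Fin 2 → ℤ) :=
  FreeGroup.lift (fun j => Multiplicative.ofAdd (Pi.single j (1 : ℤ)))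

/-- The matrix of the map induced on the lattice by an endomorphism of the free group: its
columns are the abelianized images of the two generators. -/
def abMatrix (f : F2 →* F2) : Matrix (Fin 2) (Fin 2) ℤ :=
  Matrix.of fun i j => Multiplicative.toAdd (ab (f (FreeGroup.of j))) i

/-- The matrix of an endomorphism describes the induced map on the abelianization. -/
theorem ab_apply (f : F2 →* F2) (w : F2) :
    Multiplicative.toAdd (ab (f w)) = abMatrix f *ᵥ Multiplicative.toAdd (ab w) := by
  have h : ab.comp f =
      (AddMonoidHom.toMultiplicative (Matrix.mulVecLin (abMatrix f)).toAddMonoidHom).comp ab := by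
    apply FreeGroup.ext_hom
    intro j
    apply Multiplicative.toAdd.injective
    ext i
    simp [ab, abMatrix]
  have h2 := congrArg Multiplicative.toAdd (DFunLike.congr_fun h w)
  simpa using h2

/-- The action of automorphisms of the free group on its abelianization, as a homomorphism to the
monoid of integer matrices. -/
def rhoMatrix : MulAut F2 →* Matrix (Fin 2) (Fin 2) ℤ where
  toFun f := abMatrix f.toMonoidHom
  map_one' := by
    ext i j
    simp [abMatrix, ab, Matrix.one_apply, Pi.single_apply]
  map_mul' f g := by
    ext i j
    have h := congrFun (ab_apply f.toMonoidHom (g (FreeGroup.of j))) i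
    exact h

/-- The homomorphism from the automorphism group of the free group to the general linear group
induced by abelianization. -/
def rho : MulAut F2 →* GL (Fin 2) ℤ := rhoMatrix.toHomUnits

/-- The group of direct automorphisms of the free group: those which induce on the abelianization
a matrix of determinant one. -/
def AutPlus : Subgroup (MulAut F2) := (Matrix.GeneralLinearGroup.det.comp rho).ker

theorem mem_AutPlus {f : MulAut F2} : f ∈ AutPlus ↔ (rhoMatrix f).det = 1 := by
  rw [AutPlus, MonoidHom.mem_ker, ← Units.val_inj]
  rfl

/-- The restriction of the abelianization homomorphism to direct automorphisms. -/
def rhoPlus : AutPlus →* SL2Z where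
  toFun f := ⟨rhoMatrix f.1, mem_AutPlus.1 f.2⟩
  map_one' := Subtype.ext (map_one rhoMatrix)
  map_mul' f g := Subtype.ext (map_mul rhoMatrix f.1 g.1)

/-! ### The distinguished automorphisms -/

/-- The endomorphism of the free group sending the generators to the two given elements. -/
def endo (x y : F2) : F2 →* F2 := FreeGroup.lift ![x, y]

@[simp] theorem endo_u (x y : F2) : endo x y u = x := by simp [endo, u]

@[simp] theorem endo_v (x y : F2) : endo x y v = y := by simp [endo, v]

theorem endo_comp_eq_id {x y x' y' : F2} (hu : endo x y x' = u) (hv : endo x y y' = v) :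
    (endo x y).comp (endo x' y') = MonoidHom.id F2 := by
  apply FreeGroup.ext_hom
  intro j
  fin_cases j
  · simpa [endo, u] using hu
  · simpa [endo, v] using hv

/-- The automorphism inverting both generators. -/
def sigmaAut : MulAut F2 :=
  MonoidHom.toMulEquiv (endo u⁻¹ v⁻¹) (endo u⁻¹ v⁻¹)
    (endo_comp_eq_id (by simp) (by simp)) (endo_comp_eq_id (by simp) (by simp))

/-- The automorphism `u ↦ v`, `v ↦ u⁻¹`. -/
def iotaAut : MulAut F2 :=
  MonoidHom.toMulEquiv (endo v u⁻¹) (endo v⁻¹ u)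
    (endo_comp_eq_id (by simp) (by simp)) (endo_comp_eq_id (by simp) (by simp))

/-- The automorphism `u ↦ v`, `v ↦ v⁻¹ u⁻¹`. -/
def zetaAut : MulAut F2 :=
  MonoidHom.toMulEquiv (endo v (v⁻¹ * u⁻¹)) (endo (v⁻¹ * u⁻¹) u)
    (endo_comp_eq_id (by simp) (by simp)) (endo_comp_eq_id (by simp) (by simp))

theorem rhoMatrix_sigmaAut : rhoMatrix sigmaAut = !![-1, 0; 0, -1] := by
  ext i j
  fin_cases i <;> fin_cases j <;>
    simp [rhoMatrix, abMatrix, sigmaAut, endo, ab, u, v]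

theorem rhoMatrix_iotaAut : rhoMatrix iotaAut = !![0, -1; 1, 0] := by
  ext i j
  fin_cases i <;> fin_cases j <;>
    simp [rhoMatrix, abMatrix, iotaAut, endo, ab, u, v]

theorem rhoMatrix_zetaAut : rhoMatrix zetaAut = !![0, -1; 1, -1] := by
  ext i j
  fin_cases i <;> fin_cases j <;>
    simp [rhoMatrix, abMatrix, zetaAut, endo, ab, u, v]

/-- The direct automorphism `u ↦ u⁻¹`, `v ↦ v⁻¹`. -/
def sigma : AutPlus :=
  ⟨sigmaAut, mem_AutPlus.2 (by rw [rhoMatrix_sigmaAut]; simp [Matrix.det_fin_two])⟩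

/-- The direct automorphism `u ↦ v`, `v ↦ u⁻¹`. -/
def iota : AutPlus :=
  ⟨iotaAut, mem_AutPlus.2 (by rw [rhoMatrix_iotaAut]; simp [Matrix.det_fin_two])⟩

/-- The direct automorphism `u ↦ v`, `v ↦ v⁻¹ u⁻¹`. -/
def zeta : AutPlus :=
  ⟨zetaAut, mem_AutPlus.2 (by rw [rhoMatrix_zetaAut]; simp [Matrix.det_fin_two])⟩

/-! ### The distinguished matrices -/

def A : SL2Z := ⟨!![1, -1; 0, 1], by simp [Matrix.det_fin_two]⟩

def B : SL2Z := ⟨!![1, 0; 1, 1], by simp [Matrix.det_fin_two]⟩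

def S : SL2Z := ⟨!![0, -1; 1, 0], by simp [Matrix.det_fin_two]⟩

end TorsionAutFTwo

namespace TorsionAutFTwo

open Matrix

/-! ### Torsion in the special linear group -/

/-! Torsion in `SL2Z`: by Cayley–Hamilton a power of g is p g − q, with |q| < |p| once the trace is
at least two in absolute value. So torsion other than ±1 has trace −1, 0 or 1. Translations and the
rotation S then give a Euclidean descent on the lower-left entry, ending at a companion matrix up to
the sign of its off-diagonal entries. A conjugator from a representative to its inverse would have
negative determinant.

For lifts, the key fact is that the kernel of `rhoPlus` consists of inner automorphisms
(`exists_eq_inn`). By Nielsen reduction, `iota`, `zeta` and the inner automorphisms generate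
`AutPlus` (`genSubgroup_eq_top`). Modulo inner automorphisms, relations of `SL2Z` hold that yield a
normal form on which the map to `SL2Z` is visibly injective. A lift of the matrix of f is therefore
`inn w * f`, conjugation by inner automorphisms acts on w by twisted conjugation y w f(y)⁻¹, and
torsion becomes an equation for w.

Order two: `sigma` inverts w exactly when w is a palindrome, which leaves w = 1, u, v. Order four:
the square is such a lift, and parity of exponent sums selects w = 1 for it. Order six: the square
and cube commute, which parity excludes. Order three: `toSL` embeds the free group in `SL2Z` so that
conjugation by `Z` induces `zeta`; passing to `toSL w * Z` reduces the question to conjugacy in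
`SL2Z`. -/

theorem isConj_of_mul_eq {G : Type*} [Group G] {g g' : G} (h : G) (e : h * g = g' * h) :
    IsConj g g' :=
  ⟨toUnits h, e⟩

/-- The element of the special linear group with the given entries. -/
def sl (a b c d : ℤ) (h : a * d - b * c = 1) : SL2Z :=
  ⟨!![a, b; c, d], by rw [Matrix.det_fin_two_of]; exact h⟩

theorem sl_eta (g : SL2Z) : ∃ a b c d h, g = sl a b c d h := by
  refine ⟨g.1 0 0, g.1 0 1, g.1 1 0, g.1 1 1, ?_, ?_⟩
  · rw [← Matrix.det_fin_two]; exact g.2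
  · exact Subtype.ext (Matrix.eta_fin_two g.1)

theorem sl_mul {a b c d a' b' c' d' : ℤ} {h : a * d - b * c = 1} {h' : a' * d' - b' * c' = 1} :
    sl a b c d h * sl a' b' c' d' h' =
      sl (a * a' + b * c') (a * b' + b * d') (c * a' + d * c') (c * b' + d * d')
        (by linear_combination (a' * d' - b' * c') * h + h') := by
  apply Subtype.ext
  change !![a, b; c, d] * !![a', b'; c', d'] = _
  simp [sl]

theorem sl_inj {a b c d a' b' c' d' : ℤ} {h : a * d - b * c = 1} {h' : a' * d' - b' * c' = 1} :
    sl a b c d h = sl a' b' c' d' h' ↔ a = a' ∧ b = b' ∧ c = c' ∧ d = d' := by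
  constructor
  · intro e
    have e' := congrArg Subtype.val e
    exact ⟨by simpa [sl] using congrFun (congrFun e' 0) 0,
      by simpa [sl] using congrFun (congrFun e' 0) 1,
      by simpa [sl] using congrFun (congrFun e' 1) 0,
      by simpa [sl] using congrFun (congrFun e' 1) 1⟩
  · rintro ⟨rfl, rfl, rfl, rfl⟩; rfl

theorem sl_one : (1 : SL2Z) = sl 1 0 0 1 (by norm_num) := by
  apply Subtype.ext; simp [sl, Matrix.one_fin_two]

theorem sl_neg {a b c d : ℤ} {h : a * d - b * c = 1} :
    -sl a b c d h = sl (-a) (-b) (-c) (-d) (by linarith) := by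
  apply Subtype.ext
  change -!![a, b; c, d] = _
  simp [sl]

theorem sl_inv {a b c d : ℤ} {h : a * d - b * c = 1} :
    (sl a b c d h)⁻¹ = sl d (-b) (-c) a (by linarith) := by
  rw [inv_eq_iff_mul_eq_one, sl_mul, sl_one, sl_inj]
  refine ⟨?_, ?_, ?_, ?_⟩ <;> linarith

theorem S_eq : S = sl 0 (-1) 1 0 (by norm_num) := rfl

theorem BA_eq : B * A = sl 1 (-1) 1 0 (by norm_num) := by
  change sl 1 0 1 1 (by norm_num) * sl 1 (-1) 0 1 (by norm_num) = _
  rw [sl_mul, sl_inj]; norm_num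

theorem BA_zpow_two : (B * A) ^ (2 : ℤ) = sl 0 (-1) 1 (-1) (by norm_num) := by
  rw [BA_eq, zpow_ofNat, pow_two, sl_mul, sl_inj]; norm_num

theorem BA_zpow_neg_two : (B * A) ^ (-2 : ℤ) = sl (-1) 1 (-1) 0 (by norm_num) := by
  rw [_root_.zpow_neg, BA_zpow_two, sl_inv, sl_inj]; norm_num

/-- In the powers of an element of trace at least two in absolute value, written as combinations
of the element and the identity, the first coefficient dominates. -/
theorem sl_pow_succ {a b c d : ℤ} {h : a * d - b * c = 1} (ht : 2 ≤ |a + d|) (n : ℕ) :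
    ∃ p q : ℤ, |q| < |p| ∧ ∃ h', sl a b c d h ^ (n + 1) =
      sl (p * a - q) (p * b) (p * c) (p * d - q) h' := by
  induction n with
  | zero => exact ⟨1, 0, by simp, by linarith, by simp⟩
  | succ n ih =>
    obtain ⟨p, q, hpq, h', e⟩ := ih
    -- With t = a + d, g² = t g − 1 gives (p g − q) g = (p t − q) g − p, and |p t − q| ≥ 2|p| − |q|
    -- > |p|.
    refine ⟨p * (a + d) - q, p, ?_, ?_⟩
    · have h1 : |p * (a + d)| - |q| ≤ |p * (a + d) - q| := abs_sub_abs_le_abs_sub _ _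
      rw [abs_mul] at h1
      nlinarith [abs_nonneg p]
    · have e2 := pow_succ (sl a b c d h) (n + 1)
      rw [e, sl_mul] at e2
      have e3 : ((p * a - q) * a + p * b * c) = (p * (a + d) - q) * a - p ∧
          ((p * a - q) * b + p * b * d) = (p * (a + d) - q) * b ∧
          (p * c * a + (p * d - q) * c) = (p * (a + d) - q) * c ∧
          (p * c * b + (p * d - q) * d) = (p * (a + d) - q) * d - p := by
        refine ⟨?_, ?_, ?_, ?_⟩
        · linear_combination (-p) * h
        · ring
        · ring
        · linear_combination (-p) * h
      obtain ⟨e3, e4, e5, e6⟩ := e3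
      have h2 : ((p * (a + d) - q) * a - p) * ((p * (a + d) - q) * d - p) -
          ((p * (a + d) - q) * b) * ((p * (a + d) - q) * c) = 1 := by
        rw [← e3, ← e4, ← e5, ← e6]
        linear_combination (a * d - b * c) * h' + h
      exact ⟨h2, by rw [e2, sl_inj]; exact ⟨e3, e4, e5, e6⟩⟩

theorem sl_isOfFinOrder {a b c d : ℤ} {h : a * d - b * c = 1}
    (ho : IsOfFinOrder (sl a b c d h)) :
    sl a b c d h = 1 ∨ sl a b c d h = -1 ∨ |a + d| ≤ 1 := by
  by_contra! hc
  obtain ⟨h1, h2, h3⟩ := hc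
  obtain ⟨n, hn, hp⟩ := isOfFinOrder_iff_pow_eq_one.1 ho
  obtain ⟨m, rfl⟩ := Nat.exists_eq_succ_of_ne_zero hn.ne'
  obtain ⟨p, q, hpq, h', e⟩ := sl_pow_succ (h := h) (by omega) m
  have hp0 : p ≠ 0 := by
    rintro rfl
    simp only [abs_zero] at hpq
    exact absurd hpq (not_lt.2 (abs_nonneg q))
  rw [Nat.succ_eq_add_one, e, sl_one, sl_inj] at hp
  obtain ⟨-, hb, hcc, -⟩ := hp
  have hb : b = 0 := by simpa [hp0] using hb
  have hcc : c = 0 := by simpa [hp0] using hcc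
  subst hb hcc
  have had : a * d = 1 := by linarith
  rcases Int.mul_eq_one_iff_eq_one_or_neg_one.1 had with ⟨rfl, rfl⟩ | ⟨rfl, rfl⟩
  · exact h1 (by rw [sl_one])
  · exact h2 (by rw [sl_one, sl_neg, sl_inj]; norm_num)

/-- A translation fixes c and moves a − d by 2kc. Alternating it with the rotation, which exchanges
b and c up to sign, gives the descent on |c|. -/
theorem sl_isConj_shift {a b c d : ℤ} {h : a * d - b * c = 1} (k : ℤ) :
    ∃ b' h', IsConj (sl a b c d h) (sl (a + k * c) b' c (d - k * c) h') := by
  have h2 : (a + k * c) * (d - k * c) - (b + k * d - k * (a + k * c)) * c = 1 := by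
    linear_combination h
  refine ⟨b + k * d - k * (a + k * c), h2, isConj_of_mul_eq (sl 1 k 0 1 (by ring)) ?_⟩
  rw [sl_mul, sl_mul, sl_inj]
  refine ⟨?_, ?_, ?_, ?_⟩ <;> ring

theorem sl_isConj_rotate {a b c d : ℤ} {h : a * d - b * c = 1} :
    IsConj (sl a b c d h) (sl d (-c) (-b) a (by linarith)) := by
  refine isConj_of_mul_eq (sl 0 (-1) 1 0 (by norm_num)) ?_
  rw [sl_mul, sl_mul, sl_inj]
  refine ⟨?_, ?_, ?_, ?_⟩ <;> ring

theorem exists_shift_abs_le (x c : ℤ) (hc : c ≠ 0) : ∃ k : ℤ, |x + 2 * (k * c)| ≤ |c| := by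
  have hpos : 0 < 2 * |c| := by positivity
  have e := Int.emod_add_mul_ediv (x + |c|) (2 * |c|)
  have h1 := Int.emod_nonneg (x + |c|) hpos.ne'
  have h2 := Int.emod_lt_of_pos (x + |c|) hpos
  refine ⟨-((x + |c|) / (2 * |c|)) * c.sign, ?_⟩
  have h3 : -((x + |c|) / (2 * |c|)) * c.sign * c = -((x + |c|) / (2 * |c|)) * |c| := by
    rw [mul_assoc, Int.sign_mul_self_eq_abs]
  rw [h3, abs_le]
  constructor <;> nlinarith

/-- A direct integer matrix of trace at most one in absolute value is conjugate to the companion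
matrix of its characteristic polynomial or of the inverse of such a matrix. -/
theorem sl_exists_isConj_companion (n : ℕ) : ∀ {a b c d : ℤ} (h : a * d - b * c = 1),
    |a + d| ≤ 1 → c.natAbs ≤ n →
    IsConj (sl a b c d h) (sl (a + d) (-1) 1 0 (by norm_num)) ∨
      IsConj (sl a b c d h) (sl (a + d) 1 (-1) 0 (by norm_num)) := by
  induction n with
  | zero =>
    intro a b c d h ht hc
    obtain rfl : c = 0 := by omega
    have had : a * d = 1 := by linarith
    rcases Int.mul_eq_one_iff_eq_one_or_neg_one.1 had with ⟨rfl, rfl⟩ | ⟨rfl, rfl⟩ <;>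
      norm_num at ht
  | succ n ih =>
    intro a b c d h ht hc
    have hc0 : c ≠ 0 := by
      rintro rfl
      have had : a * d = 1 := by linarith
      rcases Int.mul_eq_one_iff_eq_one_or_neg_one.1 had with ⟨rfl, rfl⟩ | ⟨rfl, rfl⟩ <;>
        norm_num at ht
    by_cases hc1 : c = 1
    · subst hc1
      -- For c = 1, shifting by d makes the lower-right entry zero; the determinant fixes the rest.
      obtain ⟨b', h', e⟩ := sl_isConj_shift (h := h) d
      left
      convert e using 1
      rw [sl_inj]
      refine ⟨by ring, by linarith, rfl, by ring⟩
    by_cases hc2 : c = -1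
    · subst hc2
      obtain ⟨b', h', e⟩ := sl_isConj_shift (h := h) (-d)
      right
      convert e using 1
      rw [sl_inj]
      refine ⟨by ring, by linarith, rfl, by ring⟩
    obtain ⟨k, hk⟩ := exists_shift_abs_le (a - d) c hc0
    obtain ⟨b', h', e⟩ := sl_isConj_shift (h := h) k
    -- With δ the new diagonal difference, 4b'c = (a + d)² − 4 − δ² and |δ| ≤ |c|, so 4|b'c| ≤ c² +
    -- 4, which is less than 4c² when |c| ≥ 2.
    have hb : |b'| < |c| := by
      by_contra! hcon
      have hk2 : (a - d + 2 * (k * c)) ^ 2 ≤ c ^ 2 := sq_le_sq.2 hk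
      have ht2 : 0 ≤ (a + d) ^ 2 := sq_nonneg _
      have ht3 : (a + d) ^ 2 ≤ 1 := by
        have := sq_le_sq.2 (show |a + d| ≤ |1| by simpa using ht)
        simpa using this
      have e1 : 4 * (b' * c) = (a + d) ^ 2 - 4 - (a - d + 2 * (k * c)) ^ 2 := by
        linear_combination (-4) * h'
      have e2 : c ^ 2 ≤ |b' * c| := by
        rw [abs_mul, ← sq_abs c, pow_two]
        exact mul_le_mul_of_nonneg_right hcon (abs_nonneg c)
      have e3 : 4 * |b' * c| ≤ c ^ 2 + 4 := by
        have : |b' * c| = -(b' * c) := abs_of_nonpos (by nlinarith)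
        rw [this]; linarith
      have e4 : 2 ≤ |c| := by
        rcases abs_cases c with ⟨hh, _⟩ | ⟨hh, _⟩ <;> omega
      have e5 : 4 ≤ c ^ 2 := by rw [← sq_abs]; nlinarith
      linarith
    have h'' : (d - k * c) * (a + k * c) - (-c) * (-b') = 1 := by linarith
    have e2 : IsConj (sl a b c d h) (sl (d - k * c) (-c) (-b') (a + k * c) h'') :=
      e.trans sl_isConj_rotate
    have htr : d - k * c + (a + k * c) = a + d := by ring
    rw [Int.abs_eq_natAbs, Int.abs_eq_natAbs] at hb
    have := ih h'' (by rwa [htr]) (by rw [Int.natAbs_neg]; omega)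
    simp only [htr] at this
    exact this.imp e2.trans e2.trans

theorem orderOf_eq_of_isConj {G : Type*} [Group G] {x y : G} (h : IsConj x y) :
    orderOf x = orderOf y := by
  obtain ⟨c, rfl⟩ := isConj_iff.1 h
  exact (MulEquiv.orderOf_eq (MulAut.conj c) x).symm

theorem orderOf_neg_one_SL2Z : orderOf (-1 : SL2Z) = 2 := by
  apply orderOf_eq_prime
  · simp
  · rw [sl_one, sl_neg, Ne, sl_inj]; norm_num

theorem orderOf_S : orderOf S = 4 := by
  have h : S ^ 2 = -1 := by rw [S_eq, pow_two, sl_mul, sl_one, sl_neg, sl_inj]; norm_num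
  refine orderOf_eq_prime_pow (p := 2) (n := 1) ?_ ?_
  · rw [pow_one, h, sl_one, sl_neg, sl_inj]; norm_num
  · rw [show 2 ^ (1 + 1) = 2 * 2 from rfl, pow_mul, h]; simp

theorem BA_pow_three : (B * A) ^ 3 = -1 := by
  rw [BA_eq, pow_succ, pow_two, sl_mul, sl_mul, sl_one, sl_neg, sl_inj]; norm_num

theorem orderOf_BA : orderOf (B * A) = 6 := by
  refine orderOf_eq_of_pow_and_pow_div_prime (by norm_num) ?_ ?_
  · rw [show 6 = 3 * 2 from rfl, pow_mul, BA_pow_three]; simp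
  · intro p hp hd
    have : p ≤ 6 := Nat.le_of_dvd (by norm_num) hd
    interval_cases p
    · exact absurd hp (by norm_num)
    · exact absurd hp (by norm_num)
    · rw [show 6 / 2 = 3 from rfl, BA_pow_three, sl_one, sl_neg, Ne, sl_inj]; norm_num
    · rw [show 6 / 3 = 2 from rfl, ← zpow_natCast, show ((2 : ℕ) : ℤ) = 2 from rfl, BA_zpow_two,
        sl_one, Ne, sl_inj]; norm_num
    · exact absurd hp (by norm_num)
    · norm_num at hd
    · exact absurd hp (by norm_num)

theorem orderOf_BA_zpow_two : orderOf ((B * A) ^ (2 : ℤ)) = 3 := by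
  rw [zpow_ofNat, orderOf_pow_of_dvd (by norm_num) (by rw [orderOf_BA]; norm_num), orderOf_BA]

theorem orderOf_BA_zpow_neg_two : orderOf ((B * A) ^ (-2 : ℤ)) = 3 := by
  rw [_root_.zpow_neg, orderOf_inv, orderOf_BA_zpow_two]

/-- The conjugacy classes of torsion elements of the special linear group. -/
theorem SL2Z_torsion_cases {g : SL2Z} (ho : IsOfFinOrder g) :
    g = 1 ∨ IsConj g (-1) ∨ (IsConj g S ∨ IsConj g S⁻¹) ∨
      (IsConj g (B * A) ∨ IsConj g (B * A)⁻¹) ∨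
      (IsConj g ((B * A) ^ (2 : ℤ)) ∨ IsConj g ((B * A) ^ (-2 : ℤ))) := by
  obtain ⟨a, b, c, d, h, rfl⟩ := sl_eta g
  rcases sl_isOfFinOrder ho with e | e | e
  · exact Or.inl e
  · exact Or.inr (Or.inl (e ▸ IsConj.refl _))
  · have key := sl_exists_isConj_companion _ h e le_rfl
    rw [abs_le] at e
    have h3 : a + d = -1 ∨ a + d = 0 ∨ a + d = 1 := by omega
    rcases h3 with h3 | h3 | h3 <;> simp only [h3] at key
    · refine Or.inr (Or.inr (Or.inr (Or.inr (key.imp (fun k => k.trans ?_) fun k => k.trans ?_))))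
      · rw [BA_zpow_two]
        exact sl_isConj_rotate
      · rw [BA_zpow_neg_two]
    · exact Or.inr (Or.inr (Or.inl (key.imp (fun k => by rwa [S_eq])
        fun k => by rw [S_eq, sl_inv]; exact k)))
    · refine Or.inr (Or.inr (Or.inr (Or.inl (key.imp (fun k => by rwa [BA_eq])
        fun k => k.trans ?_))))
      refine isConj_of_mul_eq (sl 0 (-1) 1 0 (by norm_num)) ?_
      rw [BA_eq, sl_inv, sl_mul, sl_mul, sl_inj]; norm_num
end TorsionAutFTwo

namespace TorsionAutFTwo

open Matrix

/-! ### Orders of torsion elements and separation of inverse classes -/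

theorem SL2Z_exists_mul_eq {g g' : SL2Z} (h : IsConj g g') :
    ∃ a b c d h, sl a b c d h * g = g' * sl a b c d h := by
  obtain ⟨x, e⟩ := isConj_iff.1 h
  obtain ⟨a, b, c, d, hh, rfl⟩ := sl_eta x
  exact ⟨a, b, c, d, hh, by rw [← e]; group⟩

/-- The intertwining equations force c = b and d = −a, hence determinant −(a² + b²). In the two
analogous lemmas below it is −(a² + ab + b²). -/
theorem not_isConj_S_inv : ¬ IsConj S S⁻¹ := by
  intro hc
  obtain ⟨a, b, c, d, h, e⟩ := SL2Z_exists_mul_eq hc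
  rw [S_eq, sl_inv, sl_mul, sl_mul, sl_inj] at e
  obtain ⟨e1, e2, -, -⟩ := e
  obtain rfl : c = b := by linarith
  obtain rfl : d = -a := by linarith
  nlinarith [sq_nonneg a, sq_nonneg c]

theorem not_isConj_BA_inv : ¬ IsConj (B * A) (B * A)⁻¹ := by
  intro hc
  obtain ⟨a, b, c, d, h, e⟩ := SL2Z_exists_mul_eq hc
  rw [BA_eq, sl_inv, sl_mul, sl_mul, sl_inj] at e
  obtain ⟨e1, e2, -, -⟩ := e
  obtain rfl : c = a + b := by linarith
  obtain rfl : d = -a := by linarith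
  nlinarith [sq_nonneg (a + b), sq_nonneg a, sq_nonneg b]

theorem not_isConj_BA_zpow_two : ¬ IsConj ((B * A) ^ (2 : ℤ)) ((B * A) ^ (-2 : ℤ)) := by
  intro hc
  obtain ⟨a, b, c, d, h, e⟩ := SL2Z_exists_mul_eq hc
  rw [BA_zpow_two, BA_zpow_neg_two, sl_mul, sl_mul, sl_inj] at e
  obtain ⟨e1, -, e3, -⟩ := e
  obtain rfl : c = a + b := by linarith
  obtain rfl : d = -a := by linarith
  nlinarith [sq_nonneg (a + b), sq_nonneg a, sq_nonneg b]

theorem SL2Z_orderOf_cases {g : SL2Z} (ho : IsOfFinOrder g) :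
    (orderOf g = 1 ∧ g = 1) ∨ (orderOf g = 2 ∧ IsConj g (-1)) ∨
      (orderOf g = 4 ∧ (IsConj g S ∨ IsConj g S⁻¹)) ∨
      (orderOf g = 6 ∧ (IsConj g (B * A) ∨ IsConj g (B * A)⁻¹)) ∨
      (orderOf g = 3 ∧ (IsConj g ((B * A) ^ (2 : ℤ)) ∨ IsConj g ((B * A) ^ (-2 : ℤ)))) := by
  rcases SL2Z_torsion_cases ho with h | h | h | h | h
  · exact Or.inl ⟨by rw [h, orderOf_one], h⟩
  · exact Or.inr (Or.inl ⟨by rw [orderOf_eq_of_isConj h, orderOf_neg_one_SL2Z], h⟩)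
  · refine Or.inr (Or.inr (Or.inl ⟨?_, h⟩))
    rcases h with h | h
    · rw [orderOf_eq_of_isConj h, orderOf_S]
    · rw [orderOf_eq_of_isConj h, orderOf_inv, orderOf_S]
  · refine Or.inr (Or.inr (Or.inr (Or.inl ⟨?_, h⟩)))
    rcases h with h | h
    · rw [orderOf_eq_of_isConj h, orderOf_BA]
    · rw [orderOf_eq_of_isConj h, orderOf_inv, orderOf_BA]
  · refine Or.inr (Or.inr (Or.inr (Or.inr ⟨?_, h⟩)))
    rcases h with h | h
    · rw [orderOf_eq_of_isConj h, orderOf_BA_zpow_two]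
    · rw [orderOf_eq_of_isConj h, orderOf_BA_zpow_neg_two]

theorem SL2Z_orderOf_eq_six {g : SL2Z} :
    orderOf g = 6 ↔ IsConj g (B * A) ∨ IsConj g (B * A)⁻¹ := by
  constructor
  · intro h
    have := SL2Z_orderOf_cases (orderOf_pos_iff.1 (by omega : 0 < orderOf g))
    simpa [h] using this
  · rintro (h | h)
    · rw [orderOf_eq_of_isConj h, orderOf_BA]
    · rw [orderOf_eq_of_isConj h, orderOf_inv, orderOf_BA]

theorem SL2Z_orderOf_eq_four {g : SL2Z} : orderOf g = 4 ↔ IsConj g S ∨ IsConj g S⁻¹ := by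
  constructor
  · intro h
    have := SL2Z_orderOf_cases (orderOf_pos_iff.1 (by omega : 0 < orderOf g))
    simpa [h] using this
  · rintro (h | h)
    · rw [orderOf_eq_of_isConj h, orderOf_S]
    · rw [orderOf_eq_of_isConj h, orderOf_inv, orderOf_S]

theorem SL2Z_orderOf_eq_three {g : SL2Z} :
    orderOf g = 3 ↔ IsConj g ((B * A) ^ (2 : ℤ)) ∨ IsConj g ((B * A) ^ (-2 : ℤ)) := by
  constructor
  · intro h
    have := SL2Z_orderOf_cases (orderOf_pos_iff.1 (by omega : 0 < orderOf g))
    simpa only [h, Nat.reduceEqDiff, false_and, false_or, true_and] using this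
  · rintro (h | h)
    · rw [orderOf_eq_of_isConj h, orderOf_BA_zpow_two]
    · rw [orderOf_eq_of_isConj h, orderOf_BA_zpow_neg_two]

theorem SL2Z_orderOf_eq_two {g : SL2Z} : orderOf g = 2 ↔ IsConj g (-1) := by
  constructor
  · intro h
    have := SL2Z_orderOf_cases (orderOf_pos_iff.1 (by omega : 0 < orderOf g))
    simpa [h] using this
  · intro h
    rw [orderOf_eq_of_isConj h, orderOf_neg_one_SL2Z]

theorem SL2Z_torsion_orders :
    {n : ℕ | ∃ g : SL2Z, g ≠ 1 ∧ IsOfFinOrder g ∧ orderOf g = n} = {6, 4, 3, 2} := by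
  have key : ∀ {g : SL2Z} {n : ℕ}, orderOf g = n → 1 < n →
      ∃ g : SL2Z, g ≠ 1 ∧ IsOfFinOrder g ∧ orderOf g = n := by
    intro g n h hn
    refine ⟨g, ?_, orderOf_pos_iff.1 (by omega), h⟩
    rintro rfl
    rw [orderOf_one] at h
    omega
  ext n
  simp only [Set.mem_ofPred_eq, Set.mem_insert_iff, Set.mem_singleton_iff]
  constructor
  · rintro ⟨g, h1, h2, rfl⟩
    rcases SL2Z_orderOf_cases h2 with h | h | h | h | h
    · exact absurd h.2 h1
    all_goals simp [h.1]
  · rintro (rfl | rfl | rfl | rfl)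
    · exact key orderOf_BA (by norm_num)
    · exact key orderOf_S (by norm_num)
    · exact key orderOf_BA_zpow_two (by norm_num)
    · exact key orderOf_neg_one_SL2Z (by norm_num)

end TorsionAutFTwo

namespace TorsionAutFTwo

/-! ### The tree metric of a free group -/

section FreeGroupMetric

open FreeGroup

variable {α : Type*} [DecidableEq α]

/-- The length of the longest common prefix of two lists. -/
def lcp : List α → List α → ℕ
  | a :: s, b :: t => if a = b then lcp s t + 1 else 0
  | _, _ => 0

@[simp] theorem lcp_nil_left (t : List α) : lcp [] t = 0 := by simp [lcp]

@[simp] theorem lcp_nil_right (s : List α) : lcp s [] = 0 := by cases s <;> simp [lcp]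

@[simp] theorem lcp_cons (a : α) (s t : List α) : lcp (a :: s) (a :: t) = lcp s t + 1 := by
  simp [lcp]

theorem lcp_cons_of_ne {a b : α} (h : a ≠ b) (s t : List α) : lcp (a :: s) (b :: t) = 0 := by
  simp [lcp, h]

theorem lcp_comm (s t : List α) : lcp s t = lcp t s := by
  induction s generalizing t with
  | nil => simp
  | cons a s ih =>
    cases t with
    | nil => simp
    | cons b t =>
      by_cases h : a = b
      · subst h; simp [ih]
      · rw [lcp_cons_of_ne h, lcp_cons_of_ne (Ne.symm h)]

theorem lcp_self (s : List α) : lcp s s = s.length := by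
  induction s with
  | nil => simp
  | cons a s ih => simp [ih]

theorem lcp_le_length (s t : List α) : lcp s t ≤ s.length := by
  induction s generalizing t with
  | nil => simp
  | cons a s ih =>
    cases t with
    | nil => simp
    | cons b t =>
      by_cases h : a = b
      · subst h; simp [ih]
      · simp [lcp_cons_of_ne h]

/-- The ultrametric inequality behind all cancellation estimates: it expresses that the Cayley graph
is a tree. -/
theorem min_lcp_le (r s t : List α) : min (lcp r s) (lcp s t) ≤ lcp r t := by
  induction r generalizing s t with
  | nil => simp
  | cons a r ih =>
    cases s with
    | nil => simp
    | cons b s =>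
      cases t with
      | nil => simp
      | cons c t =>
        by_cases h : a = b
        · subst h
          by_cases h : a = c
          · subst h
            have := ih s t
            simp only [lcp_cons]; omega
          · simp [lcp_cons_of_ne h]
        · simp [lcp_cons_of_ne h]

theorem lcp_take (s : List α) (k : ℕ) (hk : k ≤ s.length) : lcp s (s.take k) = k := by
  induction s generalizing k with
  | nil => simp at hk; simp [hk]
  | cons a s ih =>
    cases k with
    | zero => simp
    | succ k => simpa using ih k (by simpa using hk)

/-- The Gromov product of two elements of a free group, with respect to the word metric. -/
def gp (g h : FreeGroup α) : ℕ := lcp g.toWord h.toWord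

theorem gp_comm (g h : FreeGroup α) : gp g h = gp h g := lcp_comm _ _

theorem gp_self (g : FreeGroup α) : gp g g = g.norm := lcp_self _

theorem gp_le_norm (g h : FreeGroup α) : gp g h ≤ g.norm := lcp_le_length _ _

theorem min_gp_le (f g h : FreeGroup α) : min (gp f g) (gp g h) ≤ gp f h := min_lcp_le _ _ _

theorem exists_gp_eq (g : FreeGroup α) (k : ℕ) (hk : k ≤ g.norm) :
    ∃ p : FreeGroup α, p.norm = k ∧ gp g p = k := by
  have h : (mk (g.toWord.take k)).toWord = g.toWord.take k := by
    rw [toWord_mk]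
    apply IsReduced.reduce_eq
    exact isReduced_toWord.infix (List.take_prefix _ _).isInfix
  refine ⟨mk (g.toWord.take k), ?_, ?_⟩
  · rw [FreeGroup.norm, h, List.length_take]
    exact min_eq_left hk
  · rw [gp, h]
    exact lcp_take _ _ hk

theorem norm_mk_inv_mul (s t : List (α × Bool)) (hs : IsReduced s) (ht : IsReduced t) :
    ((mk s)⁻¹ * mk t).norm + 2 * lcp s t = s.length + t.length := by
  induction s generalizing t with
  | nil =>
    have : mk ([] : List (α × Bool)) = 1 := rfl
    simp [this, FreeGroup.norm, ht.reduce_eq]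
  | cons a s ih =>
    cases t with
    | nil =>
      have : mk ([] : List (α × Bool)) = 1 := rfl
      rw [this, mul_one, norm_inv_eq]
      simp [FreeGroup.norm, hs.reduce_eq]
    | cons b t =>
      by_cases h : a = b
      · subst h
        have e : (mk (a :: s))⁻¹ * mk (a :: t) = (mk s)⁻¹ * mk t := by
          rw [← List.singleton_append, ← mul_mk, ← List.singleton_append (l := t), ← mul_mk]
          group
        have := ih t (hs.infix (List.suffix_cons _ _).isInfix)
          (ht.infix (List.suffix_cons _ _).isInfix)
        rw [e, lcp_cons, List.length_cons, List.length_cons]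
        omega
      · have hr : IsReduced (invRev (a :: s) ++ b :: t) := by
          have h1 : IsReduced (invRev (a :: s)) := by
            rw [isReduced_iff_reduce_eq, reduce_invRev, hs.reduce_eq]
          refine List.isChain_append.2 ⟨h1, ht, ?_⟩
          intro x hx y hy hxy
          simp [invRev] at hx hy
          subst hx hy
          simp only at hxy ⊢
          rcases a with ⟨a, e⟩
          rcases b with ⟨b, e'⟩
          simp only at hxy
          subst hxy
          have : e ≠ e' := fun he => h (by rw [he])
          cases e <;> cases e' <;> simp_all
        rw [lcp_cons_of_ne h, inv_mk, mul_mk, FreeGroup.norm, toWord_mk, hr.reduce_eq]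
        simp [invRev]
        omega

theorem norm_inv_mul (g h : FreeGroup α) : (g⁻¹ * h).norm + 2 * gp g h = g.norm + h.norm := by
  have := norm_mk_inv_mul g.toWord h.toWord isReduced_toWord isReduced_toWord
  rwa [mk_toWord, mk_toWord] at this

/-- Equivalent to |g| < |g²|: if g = c k c⁻¹ with k cyclically reduced and nontrivial, the lengths
are 2|c| + |k| and 2|c| + 2|k|. -/
theorem two_mul_gp_inv_lt {g : FreeGroup α} (hg : g ≠ 1) : 2 * gp g⁻¹ g < g.norm := by
  have h1 := norm_inv_mul g⁻¹ g
  rw [inv_inv, norm_inv_eq, ← pow_two] at h1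
  have h2 : (g ^ 2).norm = _ := congrArg List.length (toWord_pow g 2)
  rw [reduceCyclically.reduce_flatten_replicate isReduced_toWord] at h2
  have h3 := reduceCyclically.conj_conjugator_reduceCyclically g.toWord
  have h4 := congrArg List.length h3
  have h5 : reduceCyclically g.toWord ≠ [] := by
    intro h
    rw [h, List.append_nil] at h3
    apply hg
    rw [← mk_toWord (x := g), ← h3, ← mul_mk, ← inv_mk, mul_inv_cancel]
  have h6 := List.length_pos_of_ne_nil h5
  simp [List.replicate_succ] at h2 h4
  have h7 : g.norm = g.toWord.length := rfl
  omega

end FreeGroupMetric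

end TorsionAutFTwo

namespace TorsionAutFTwo

/-! ### Nielsen reduction of pairs -/

section Nielsen

open FreeGroup

variable {α : Type*} [DecidableEq α]

/-- The pair `(x, y)` is at most as long as all conjugates of `(x * y, y)`. -/
def TransvectionMin (x y : FreeGroup α) : Prop :=
  ∀ g : FreeGroup α, x.norm + y.norm ≤ (g⁻¹ * (x * y) * g).norm + (g⁻¹ * y * g).norm

/-- The pair `(x, y)` is at most as long as all its images under elementary transvections and
conjugations. -/
def PairMin (x y : FreeGroup α) : Prop :=
  TransvectionMin x y ∧ TransvectionMin x⁻¹ y ∧ TransvectionMin y x ∧ TransvectionMin y⁻¹ x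

variable {x y : FreeGroup α}

/-- Up to inversion and conjugation by y, the pair (x y⁻¹, y⁻¹) is (x⁻¹ y, y). Allowing conjugates
in the definition thus makes minimality of pairs invariant under inverting either entry. -/
theorem TransvectionMin.inv_swap (h : TransvectionMin x⁻¹ y) : TransvectionMin x y⁻¹ := by
  intro g
  have := h (y⁻¹ * g)
  have e1 : (g⁻¹ * (x * y⁻¹) * g) = ((y⁻¹ * g)⁻¹ * (x⁻¹ * y) * (y⁻¹ * g))⁻¹ := by group
  have e2 : g⁻¹ * y⁻¹ * g = ((y⁻¹ * g)⁻¹ * y * (y⁻¹ * g))⁻¹ := by group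
  rwa [e1, e2, norm_inv_eq, norm_inv_eq, norm_inv_eq, ← norm_inv_eq (x := x)]

theorem PairMin.swap (h : PairMin x y) : PairMin y x :=
  ⟨h.2.2.1, h.2.2.2, h.1, h.2.1⟩

theorem PairMin.inv_left (h : PairMin x y) : PairMin x⁻¹ y :=
  ⟨h.2.1, by rw [inv_inv]; exact h.1, h.2.2.2.inv_swap,
    TransvectionMin.inv_swap (by rw [inv_inv]; exact h.2.2.1)⟩

theorem PairMin.inv_right (h : PairMin x y) : PairMin x y⁻¹ := h.swap.inv_left.swap

theorem PairMin.two_mul_gp_le_right (h : PairMin x y) : 2 * gp x y ≤ y.norm := by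
  have h1 := h.2.1 1
  have h2 := norm_inv_mul x y
  simp only [inv_one, one_mul, mul_one, norm_inv_eq] at h1
  omega

theorem PairMin.two_mul_gp_le_left (h : PairMin x y) : 2 * gp x y ≤ x.norm := by
  rw [gp_comm]
  exact h.swap.two_mul_gp_le_right

/-- If half of `x` cancelled on both sides in `y * x * y`, then conjugation by the first half of
`x` would shorten the pair `(x, x * y)`. -/
theorem PairMin.gp_add_gp_lt (h : PairMin x y) (hx : x ≠ 1) : gp y⁻¹ x + gp x⁻¹ y < x.norm := by
  have h1 := h.inv_right.swap.two_mul_gp_le_right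
  have h2 := h.inv_left.two_mul_gp_le_left
  rw [norm_inv_eq] at h2
  have h5 := h.inv_left.two_mul_gp_le_right
  by_contra! hc
  obtain ⟨m, hm⟩ : ∃ m, gp x⁻¹ y = m := ⟨_, rfl⟩
  have hm1 : x.norm = 2 * m := by omega
  have hm2 : gp y⁻¹ x = m := by omega
  have hm0 : m ≠ 0 := by
    rintro rfl
    exact hx (norm_eq_zero.1 (by omega))
  -- Both cancellations are now exactly half of x; p is its first half.
  obtain ⟨p, hp, hxp⟩ := exists_gp_eq x m (by omega)
  -- `q` is the second half of `x`, inverted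
  obtain ⟨q, hq⟩ : ∃ q, q = x⁻¹ * p := ⟨_, rfl⟩
  have hqn : q.norm = m := by
    have := norm_inv_mul x p
    rw [← hq] at this
    omega
  have hqx : gp q x⁻¹ = m := by
    have := norm_inv_mul q x⁻¹
    rw [hq, show (x⁻¹ * p)⁻¹ * x⁻¹ = p⁻¹ by group, ← hq, norm_inv_eq, norm_inv_eq] at this
    omega
  have hqy : m ≤ gp q y := by
    have := min_gp_le q x⁻¹ y
    omega
  have hqy' : gp q y = m := le_antisymm ((gp_le_norm q y).trans hqn.le) hqy
  have hqyn := norm_inv_mul q y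
  have hyp : m ≤ gp y⁻¹ p := by
    have := min_gp_le y⁻¹ x p
    omega
  have hr : m ≤ gp (y⁻¹ * q) y⁻¹ := by
    have := norm_inv_mul (y⁻¹ * q) y⁻¹
    rw [show (y⁻¹ * q)⁻¹ * y⁻¹ = q⁻¹ by group, norm_inv_eq, norm_inv_eq,
      ← norm_inv_eq (x := y⁻¹ * q), show (y⁻¹ * q)⁻¹ = q⁻¹ * y by group] at this
    omega
  have hrp : m ≤ gp (y⁻¹ * q) p := by
    have := min_gp_le (y⁻¹ * q) y⁻¹ p
    omega
  -- The word y begins with q and ends with p⁻¹, without overlap since 2m ≤ |y|; passing to q⁻¹ y p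
  -- strips both.
  have hlong : (p⁻¹ * (x * y) * p).norm + 2 * m ≤ y.norm := by
    have := norm_inv_mul (y⁻¹ * q) p
    rw [← norm_inv_eq (x := y⁻¹ * q), show (y⁻¹ * q)⁻¹ = q⁻¹ * y by group] at this
    rw [show p⁻¹ * (x * y) * p = q⁻¹ * y * p by rw [hq]; group]
    omega
  have hshort : (p⁻¹ * x * p).norm ≤ 2 * m := by
    have := norm_mul_le q⁻¹ p
    rw [norm_inv_eq] at this
    rw [show p⁻¹ * x * p = q⁻¹ * p by rw [hq]; group]
    omega
  have := h.2.2.1 (x⁻¹ * p)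
  rw [show (x⁻¹ * p)⁻¹ * (y * x) * (x⁻¹ * p) = p⁻¹ * (x * y) * p by group,
    show (x⁻¹ * p)⁻¹ * x * (x⁻¹ * p) = p⁻¹ * x * p by group] at this
  omega

/-- In a reduced word, b stands for the inverse of the syllable before x and c for the one after it:
cancellation from both sides never consumes x. Each side takes at most half, and equality on both
sides is excluded by the ultrametric inequality or by `PairMin.gp_add_gp_lt`. -/
theorem PairMin.letters_gp_add_gp_lt (h : PairMin x y) (hx : x ≠ 1) {b c : FreeGroup α}
    (hb : b = x⁻¹ ∨ b = y ∨ b = y⁻¹) (hc : c = x ∨ c = y ∨ c = y⁻¹) :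
    gp b x + gp x⁻¹ c < x.norm := by
  have h0 := two_mul_gp_inv_lt hx
  have h1 := h.two_mul_gp_le_left
  have h2 := h.inv_left.two_mul_gp_le_left
  have h3 := h.inv_right.two_mul_gp_le_left
  have h4 := h.inv_left.inv_right.two_mul_gp_le_left
  have h5 := h.gp_add_gp_lt hx
  have h6 := h.inv_right.gp_add_gp_lt hx
  rw [inv_inv] at h6
  rw [norm_inv_eq] at h2 h4
  have h7 := min_gp_le x⁻¹ y x
  have h8 := min_gp_le x⁻¹ y⁻¹ x
  rw [gp_comm x] at h1 h3
  rcases hb with rfl | rfl | rfl <;> rcases hc with rfl | rfl | rfl <;> omega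

/-- A letter of the free group of rank two. -/
def letter (l : Fin 2 × Bool) : F2 := mk [l]

theorem letter_eq (l : Fin 2 × Bool) :
    letter l = u ∨ letter l = u⁻¹ ∨ letter l = v ∨ letter l = v⁻¹ := by
  rcases l with ⟨i, b⟩
  fin_cases i <;> cases b
  · exact Or.inr (Or.inl rfl)
  · exact Or.inl rfl
  · exact Or.inr (Or.inr (Or.inr rfl))
  · exact Or.inr (Or.inr (Or.inl rfl))

theorem letter_inv (l : Fin 2 × Bool) : (letter l)⁻¹ = letter (l.1, !l.2) := by
  simp [letter, invRev]

theorem letter_mul_mk (l : Fin 2 × Bool) (L : List (Fin 2 × Bool)) :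
    mk (l :: L) = letter l * mk L := by
  rw [letter, mul_mk, List.singleton_append]

variable {φ : F2 →* FreeGroup α}

theorem exists_partner (h : PairMin (φ u) (φ v)) (l : Fin 2 × Bool) :
    ∃ o, PairMin (φ (letter l)) o ∧ ∀ m, m ≠ l →
      m = (l.1, !l.2) ∨ φ (letter m) = o ∨ φ (letter m) = o⁻¹ := by
  have e1 : letter (0, true) = u := rfl
  have e2 : letter (0, false) = u⁻¹ := rfl
  have e3 : letter (1, true) = v := rfl
  have e4 : letter (1, false) = v⁻¹ := rfl
  rcases l with ⟨i, b⟩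
  fin_cases i <;> cases b
  · refine ⟨φ v, by simpa [e2] using h.inv_left, ?_⟩
    rintro ⟨j, b'⟩ hm
    fin_cases j <;> cases b' <;> simp_all
  · refine ⟨φ v, by simpa [e1] using h, ?_⟩
    rintro ⟨j, b'⟩ hm
    fin_cases j <;> cases b' <;> simp_all
  · refine ⟨φ u, by simpa [e4] using h.swap.inv_left, ?_⟩
    rintro ⟨j, b'⟩ hm
    fin_cases j <;> cases b' <;> simp_all
  · refine ⟨φ u, by simpa [e3] using h.swap, ?_⟩
    rintro ⟨j, b'⟩ hm
    fin_cases j <;> cases b' <;> simp_all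

theorem gp_letters_lt (h : PairMin (φ u) (φ v)) (hu : φ u ≠ 1) (hv : φ v ≠ 1)
    {l m k : Fin 2 × Bool} (hm : m ≠ l) (hk : k ≠ (l.1, !l.2)) :
    gp (φ (letter m)) (φ (letter l)) + gp (φ (letter l))⁻¹ (φ (letter k)) <
      (φ (letter l)).norm := by
  obtain ⟨o, ho, hl⟩ := exists_partner h l
  refine ho.letters_gp_add_gp_lt ?_
    ((hl m hm).imp_left fun e => by rw [e, ← letter_inv, _root_.map_inv]) ?_
  · rcases letter_eq l with e | e | e | e <;> rw [e] <;> simpa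
  · by_cases hkl : k = l
    · exact Or.inl (by rw [hkl])
    · rcases hl k hkl with e | e | e
      · exact absurd e hk
      · exact Or.inr (Or.inl e)
      · exact Or.inr (Or.inr e)

/-- The first inequality says that enough of the first syllable survives for anything multiplied on
the left to see only that syllable. It is the invariant that lets the length count in the second
pass to longer words. -/
theorem image_isReduced (h : PairMin (φ u) (φ v)) (hu : φ u ≠ 1) (hv : φ v ≠ 1)
    (L : List (Fin 2 × Bool)) : ∀ l, IsReduced (l :: L) → ∀ m, m ≠ l →
      gp (φ (letter m)) (φ (letter l)) < gp (φ (mk (l :: L))) (φ (letter l)) ∧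
      (l :: L).length + gp (φ (letter m)) (φ (letter l)) ≤ (φ (mk (l :: L))).norm := by
  induction L with
  | nil =>
    intro l _ m hm
    have h1 := gp_letters_lt h hu hv hm (k := l) (fun e => by simpa using congrArg Prod.snd e)
    change _ < gp (φ (letter l)) _ ∧ 1 + _ ≤ (φ (letter l)).norm
    rw [gp_self]
    omega
  | cons l₂ L ih =>
    intro l hL m hm
    rw [isReduced_cons_cons] at hL
    have hl₂ : l₂ ≠ (l.1, !l.2) := by
      rintro rfl
      simpa using hL.1 rfl
    have h1 := gp_letters_lt h hu hv hm hl₂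
    obtain ⟨h2, h3⟩ := ih l₂ hL.2 (l.1, !l.2) hl₂.symm
    rw [← letter_inv, _root_.map_inv] at h2 h3
    rw [letter_mul_mk l, _root_.map_mul]
    generalize φ (mk (l₂ :: L)) = W at *
    generalize φ (letter l) = a at *
    generalize φ (letter m) = b at *
    generalize φ (letter l₂) = a₂ at *
    -- By `h2`, W agrees with a₂ beyond the point where a⁻¹ leaves a₂, so the Gromov products of a⁻¹
    -- with W and with a₂ coincide.
    have h4 := min_gp_le W a₂ a⁻¹
    have h5 := min_gp_le a₂ W a⁻¹
    have h6 := norm_inv_mul a⁻¹ W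
    have h7 := norm_inv_mul (a * W) a
    rw [show (a * W)⁻¹ * a = W⁻¹ by group, norm_inv_eq] at h7
    rw [inv_inv, norm_inv_eq] at h6
    rw [gp_comm a₂ W] at h5
    rw [gp_comm a₂ a⁻¹] at h4 h5
    rw [gp_comm W a⁻¹] at h4 h5
    simp only [List.length_cons] at h3 ⊢
    omega

/-- Evaluation at a minimal pair does not decrease the length. -/
theorem norm_le_norm_map (h : PairMin (φ u) (φ v)) (hu : φ u ≠ 1) (hv : φ v ≠ 1) (w : F2) :
    w.norm ≤ (φ w).norm := by
  rcases hL : w.toWord with _ | ⟨l, L⟩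
  · rw [toWord_eq_nil_iff.1 hL, FreeGroup.norm_one]
    exact Nat.zero_le _
  · have hr : IsReduced (l :: L) := hL ▸ isReduced_toWord
    have h1 := image_isReduced h hu hv L l hr (l.1, !l.2)
      (fun e => by simpa using congrArg Prod.snd e)
    rw [← hL, mk_toWord] at h1
    exact (Nat.le_add_right _ _).trans h1.2

end Nielsen

end TorsionAutFTwo

namespace TorsionAutFTwo

open Matrix

/-! ### Inner automorphisms and generators of the group of direct automorphisms -/

@[simp] theorem sigma_u : sigma.1 u = u⁻¹ := endo_u u⁻¹ v⁻¹
@[simp] theorem sigma_v : sigma.1 v = v⁻¹ := endo_v u⁻¹ v⁻¹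
@[simp] theorem iota_u : iota.1 u = v := endo_u v u⁻¹
@[simp] theorem iota_v : iota.1 v = u⁻¹ := endo_v v u⁻¹
@[simp] theorem zeta_u : zeta.1 u = v := endo_u v (v⁻¹ * u⁻¹)
@[simp] theorem zeta_v : zeta.1 v = v⁻¹ * u⁻¹ := endo_v v (v⁻¹ * u⁻¹)

theorem F2_hom_ext {G : Type*} [Monoid G] {f g : F2 →* G} (hu : f u = g u) (hv : f v = g v) :
    f = g := by
  apply FreeGroup.ext_hom
  intro j
  fin_cases j
  · exact hu
  · exact hv

theorem AutPlus_ext {f g : AutPlus} (hu : f.1 u = g.1 u) (hv : f.1 v = g.1 v) : f = g := by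
  have := F2_hom_ext (f := f.1.toMonoidHom) (g := g.1.toMonoidHom) hu hv
  exact Subtype.ext (MulEquiv.ext fun w => DFunLike.congr_fun this w)

@[simp] theorem iota_symm_u : MulEquiv.symm iota.1 u = v⁻¹ := by
  rw [MulEquiv.symm_apply_eq]; simp

@[simp] theorem iota_symm_v : MulEquiv.symm iota.1 v = u := by
  rw [MulEquiv.symm_apply_eq]; simp

theorem conj_mem_AutPlus (w : F2) : MulAut.conj w ∈ AutPlus := by
  rw [mem_AutPlus]
  have : rhoMatrix (MulAut.conj w) = rhoMatrix 1 := by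
    ext i j
    simp [rhoMatrix, abMatrix]
  rw [this, map_one, det_one]

/-- The inner automorphisms, as direct automorphisms. -/
def inn : F2 →* AutPlus := MulAut.conj.codRestrict AutPlus conj_mem_AutPlus

@[simp] theorem inn_apply (w x : F2) : (inn w).1 x = w * x * w⁻¹ := rfl

@[simp] theorem inn_symm_apply (w x : F2) : MulEquiv.symm (inn w).1 x = w⁻¹ * x * w := rfl

theorem conj_inn (f : AutPlus) (w : F2) : f * inn w * f⁻¹ = inn (f.1 w) := by
  rw [mul_inv_eq_iff_eq_mul]
  apply AutPlus_ext <;> simp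

theorem mul_inn (f : AutPlus) (w : F2) : f * inn w = inn (f.1 w) * f := by
  rw [← conj_inn]; group

theorem rhoPlus_inn (w : F2) : rhoPlus (inn w) = 1 := by
  apply Subtype.ext
  change rhoMatrix (MulAut.conj w) = 1
  rw [← map_one rhoMatrix]
  ext i j
  simp [rhoMatrix, abMatrix]

theorem rhoPlus_sigma : rhoPlus sigma = -1 := by
  apply Subtype.ext
  change rhoMatrix sigmaAut = -1
  rw [rhoMatrix_sigmaAut, Matrix.one_fin_two]
  simp

theorem rhoPlus_iota : rhoPlus iota = S := Subtype.ext rhoMatrix_iotaAut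

theorem rhoPlus_zeta : rhoPlus zeta = sl 0 (-1) 1 (-1) (by norm_num) :=
  Subtype.ext rhoMatrix_zetaAut

theorem iota_sq : iota ^ 2 = sigma := by
  apply AutPlus_ext <;> simp [pow_two]

theorem sigma_sq : sigma ^ 2 = 1 := by
  apply AutPlus_ext <;> simp [pow_two]

theorem zeta_pow_three : zeta ^ 3 = 1 := by
  apply AutPlus_ext <;> simp [pow_succ]

theorem sigma_mul_zeta : sigma * zeta = inn v * zeta * sigma := by
  apply AutPlus_ext <;> simp [mul_assoc]

/-- The subgroup generated by the inner automorphisms and the distinguished automorphisms. -/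
def genSubgroup : Subgroup AutPlus := Subgroup.closure ({iota, zeta} ∪ Set.range inn)

theorem iota_mem : iota ∈ genSubgroup := Subgroup.subset_closure (by simp)

theorem zeta_mem : zeta ∈ genSubgroup := Subgroup.subset_closure (by simp)

theorem inn_mem (w : F2) : inn w ∈ genSubgroup := Subgroup.subset_closure (by simp)

/-- The direct automorphism `u ↦ u * v`, `v ↦ v`. -/
def tau : AutPlus := zeta * iota⁻¹

@[simp] theorem tau_u : tau.1 u = u * v := by simp [tau]
@[simp] theorem tau_v : tau.1 v = v := by simp [tau]

@[simp] theorem tau_symm_v : MulEquiv.symm tau.1 v = v := by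
  rw [MulEquiv.symm_apply_eq]; simp

@[simp] theorem tau_symm_u : MulEquiv.symm tau.1 u = u * v⁻¹ := by
  rw [MulEquiv.symm_apply_eq]; simp

theorem tau_mem : tau ∈ genSubgroup := mul_mem zeta_mem (inv_mem iota_mem)

theorem pairMin_of_minimal {f : AutPlus}
    (hf : ∀ n ∈ genSubgroup, (f.1 u).norm + (f.1 v).norm ≤
      ((f * n).1 u).norm + ((f * n).1 v).norm) : PairMin (f.1 u) (f.1 v) := by
  have key : ∀ n ∈ genSubgroup, ∀ g : F2, (f.1 u).norm + (f.1 v).norm ≤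
      (g⁻¹ * f.1 (n.1 u) * g).norm + (g⁻¹ * f.1 (n.1 v) * g).norm := by
    intro n hn g
    -- Moved past f, this inner automorphism becomes conjugation by g⁻¹.
    have := hf (inn (f.1⁻¹ g⁻¹) * n) (mul_mem (inn_mem _) hn)
    simpa using this
  refine ⟨fun g => ?_, fun g => ?_, fun g => ?_, fun g => ?_⟩
  · simpa using key tau tau_mem g
  · have := key (inn v⁻¹ * tau⁻¹) (mul_mem (inn_mem _) (inv_mem tau_mem)) g
    rw [FreeGroup.norm_inv_eq, ← FreeGroup.norm_inv_eq (x := g⁻¹ * ((f.1 u)⁻¹ * _) * g)]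
    simpa [mul_assoc] using this
  · have := key (iota * tau⁻¹ * iota⁻¹)
      (mul_mem (mul_mem iota_mem (inv_mem tau_mem)) (inv_mem iota_mem)) g
    rw [add_comm, add_comm (FreeGroup.norm (g⁻¹ * _ * g))]
    simpa [mul_assoc] using this
  · have := key (inn u⁻¹ * (iota * tau * iota⁻¹))
      (mul_mem (inn_mem _) (mul_mem (mul_mem iota_mem tau_mem) (inv_mem iota_mem))) g
    rw [FreeGroup.norm_inv_eq, ← FreeGroup.norm_inv_eq (x := g⁻¹ * ((f.1 v)⁻¹ * _) * g), add_comm,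
      add_comm (FreeGroup.norm (g⁻¹ * _ * g)⁻¹)]
    simpa [mul_assoc] using this

theorem exists_letter_of_norm_le_one {w : F2} (hw : w ≠ 1) (h : w.norm ≤ 1) :
    w = u ∨ w = u⁻¹ ∨ w = v ∨ w = v⁻¹ := by
  rcases hL : w.toWord with _ | ⟨l, _ | ⟨l', L⟩⟩
  · exact absurd (FreeGroup.toWord_eq_nil_iff.1 hL) hw
  · rw [← FreeGroup.mk_toWord (x := w), hL]
    exact letter_eq l
  · have : w.norm = w.toWord.length := rfl
    rw [hL] at this
    simp only [List.length_cons] at this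
    omega

theorem rhoMatrix_det (f : AutPlus) :
    (ab (f.1 u)).toAdd 0 * (ab (f.1 v)).toAdd 1 - (ab (f.1 v)).toAdd 0 * (ab (f.1 u)).toAdd 1
      = 1 := by
  rw [← mem_AutPlus.1 f.2, Matrix.det_fin_two]
  rfl

@[simp] theorem ab_u : ab u = Multiplicative.ofAdd ![1, 0] := by
  apply Multiplicative.toAdd.injective
  ext i
  fin_cases i <;> simp [ab, u]

@[simp] theorem ab_v : ab v = Multiplicative.ofAdd ![0, 1] := by
  apply Multiplicative.toAdd.injective
  ext i
  fin_cases i <;> simp [ab, v]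

/-- Determinant one leaves only the four powers of `iota` among the sixteen assignments. -/
theorem mem_genSubgroup_of_letters {f : AutPlus}
    (hu : f.1 u = u ∨ f.1 u = u⁻¹ ∨ f.1 u = v ∨ f.1 u = v⁻¹)
    (hv : f.1 v = u ∨ f.1 v = u⁻¹ ∨ f.1 v = v ∨ f.1 v = v⁻¹) : f ∈ genSubgroup := by
  have hd := rhoMatrix_det f
  rcases hu with e | e | e | e <;> rcases hv with e' | e' | e' | e' <;> rw [e, e'] at hd <;>
    simp at hd
  · have : f = 1 := AutPlus_ext (by simp [e]) (by simp [e'])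
    rw [this]
    exact one_mem _
  · have : f = iota ^ 2 := AutPlus_ext (by simp [e, pow_two]) (by simp [e', pow_two])
    rw [this]
    exact pow_mem iota_mem _
  · have : f = iota := AutPlus_ext (by simp [e]) (by simp [e'])
    rw [this]
    exact iota_mem
  · have : f = iota⁻¹ := AutPlus_ext (by simp [e]) (by simp [e'])
    rw [this]
    exact inv_mem iota_mem

theorem u_ne_one : u ≠ 1 := FreeGroup.of_ne_one _
theorem v_ne_one : v ≠ 1 := FreeGroup.of_ne_one _

/-- A shortest g in the coset of f gives a minimal pair, so g never decreases length. As g sends g⁻¹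
u and g⁻¹ v to words of length one, these are themselves letters. -/
theorem genSubgroup_eq_top : genSubgroup = ⊤ := by
  rw [eq_top_iff]
  intro f _
  obtain ⟨n₀, hn₀, hmin⟩ : ∃ n₀ ∈ genSubgroup, ∀ n ∈ genSubgroup,
      ((f * n₀).1 u).norm + ((f * n₀).1 v).norm ≤ ((f * n).1 u).norm + ((f * n).1 v).norm := by
    let c : AutPlus → ℕ := fun n => ((f * n).1 u).norm + ((f * n).1 v).norm
    have hne : (genSubgroup : Set AutPlus).Nonempty := ⟨1, one_mem _⟩
    exact ⟨Function.argminOn c _ hne, Function.argminOn_mem c _ hne,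
      fun n hn => Function.argminOn_le c _ hn⟩
  set g := f * n₀ with hg
  have hp : PairMin (g.1 u) (g.1 v) := by
    apply pairMin_of_minimal
    intro n hn
    have := hmin (n₀ * n) (mul_mem hn₀ hn)
    rwa [← mul_assoc] at this
  have hlen : ∀ w : F2, w.norm ≤ (g.1 w).norm :=
    norm_le_norm_map (φ := g.1.toMonoidHom) hp (by simpa using u_ne_one) (by simpa using v_ne_one)
  have hu := hlen (g.1⁻¹ u)
  have hv := hlen (g.1⁻¹ v)
  rw [MulAut.apply_inv_self, show u.norm = 1 from FreeGroup.norm_of _] at hu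
  rw [MulAut.apply_inv_self, show v.norm = 1 from FreeGroup.norm_of _] at hv
  have hgm : g⁻¹ ∈ genSubgroup := mem_genSubgroup_of_letters
    (exists_letter_of_norm_le_one (by simpa using u_ne_one) hu)
    (exists_letter_of_norm_le_one (by simpa using v_ne_one) hv)
  have : f = g * n₀⁻¹ := by rw [hg]; group
  rw [this]
  exact mul_mem (inv_mem_iff.1 hgm) (inv_mem hn₀)

end TorsionAutFTwo

namespace TorsionAutFTwo

open Matrix

/-! ### The kernel and the image of the abelianization map -/

section NormalForm

variable {G : Type*} [Group G] {s r : G}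

/-- A normal form in groups satisfying the relations of the special linear group. -/
theorem exists_normalForm (hgen : Subgroup.closure {s, r} = ⊤) (hs : s ^ 4 = 1) (hr : r ^ 3 = 1)
    (hz : Commute (s ^ 2) r) (g : G) :
    ∃ i < 3, ∃ j < 4, ∃ W ∈ Submonoid.closure {s * r, s⁻¹ * r⁻¹}, g = r ^ i * W * s ^ j := by
  set 𝒲 := Submonoid.closure {s * r, s⁻¹ * r⁻¹} with h𝒲
  suffices h : ∃ i j : ℕ, ∃ W ∈ 𝒲, g = r ^ i * W * s ^ j by
    obtain ⟨i, j, W, hW, rfl⟩ := h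
    exact ⟨i % 3, Nat.mod_lt _ (by norm_num), j % 4, Nat.mod_lt _ (by norm_num), W, hW,
      by rw [← pow_eq_pow_mod i hr, ← pow_eq_pow_mod j hs]⟩
  have hR : s * r ∈ 𝒲 := Submonoid.subset_closure (by simp)
  have hL : s⁻¹ * r⁻¹ ∈ 𝒲 := Submonoid.subset_closure (by simp)
  have hzs : Commute (s ^ 2) s := Commute.pow_self s 2
  have hzW : ∀ W ∈ 𝒲, s ^ 2 * W = W * s ^ 2 := by
    intro W hW
    change Commute (s ^ 2) W
    induction hW using Submonoid.closure_induction with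
    | mem x hx =>
      rcases hx with rfl | rfl
      · exact hzs.mul_right hz
      · exact hzs.inv_right.mul_right hz.inv_right
    | one => exact Commute.one_right _
    | mul x y _ _ hx hy => exact hx.mul_right hy
  have hmulr : ∀ g, (∃ i j : ℕ, ∃ W ∈ 𝒲, g = r ^ i * W * s ^ j) →
      ∃ i j : ℕ, ∃ W ∈ 𝒲, r * g = r ^ i * W * s ^ j := by
    rintro _ ⟨i, j, W, hW, rfl⟩
    exact ⟨i + 1, j, W, hW, by rw [pow_succ']; simp only [mul_assoc]⟩
  have hmuls : ∀ g, (∃ i j : ℕ, ∃ W ∈ 𝒲, g = r ^ i * W * s ^ j) →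
      ∃ i j : ℕ, ∃ W ∈ 𝒲, s * g = r ^ i * W * s ^ j := by
    rintro _ ⟨i, j, W, hW, rfl⟩
    rw [pow_eq_pow_mod i hr]
    have hi : i % 3 < 3 := Nat.mod_lt _ (by norm_num)
    -- For i = 0 the head of W, if any, is absorbed; i = 1 creates the syllable s r; i = 2 creates
    -- s⁻¹ r⁻¹, since s r² = s² (s⁻¹ r⁻¹) and s² is central.
    interval_cases i % 3
    · induction hW using Submonoid.closure_induction_left with
      | one => exact ⟨0, j + 1, 1, one_mem _, by simp [pow_succ']⟩
      | mul_left x hx y hy _ =>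
        rcases hx with rfl | rfl
        · refine ⟨1, j + 2, y, hy, ?_⟩
          calc s * (r ^ 0 * (s * r * y) * s ^ j) = (s ^ 2 * r) * y * s ^ j := by
                rw [pow_two]; simp [mul_assoc]
            _ = r * (s ^ 2 * y) * s ^ j := by rw [hz.eq]; simp only [mul_assoc]
            _ = r ^ 1 * y * s ^ (j + 2) := by
                rw [hzW y hy, pow_one, add_comm j, pow_add]; simp only [mul_assoc]
        · refine ⟨2, j, y, hy, ?_⟩
          have : r⁻¹ = r ^ 2 := by rw [inv_eq_iff_mul_eq_one, ← pow_succ', hr]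
          rw [← this]
          simp [mul_assoc]
    · exact ⟨0, j, s * r * W, mul_mem hR hW, by simp [mul_assoc]⟩
    · refine ⟨0, j + 2, s⁻¹ * r⁻¹ * W, mul_mem hL hW, ?_⟩
      have : r ^ 2 = r⁻¹ := by rw [eq_inv_iff_mul_eq_one, ← pow_succ, hr]
      rw [this, add_comm j, pow_add, pow_zero, one_mul, ← mul_assoc (_ * W),
        ← hzW _ (mul_mem hL hW), pow_two]
      simp [mul_assoc]
  have hg : g ∈ Subgroup.closure {s, r} := hgen ▸ Subgroup.mem_top g
  have hrinv : r⁻¹ = r * r := by rw [inv_eq_iff_mul_eq_one, ← hr, pow_succ', pow_two]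
  have hsinv : s⁻¹ = s * (s * s) := by
    rw [inv_eq_iff_mul_eq_one, ← hs, pow_succ', pow_succ', pow_two]
  induction hg using Subgroup.closure_induction_left with
  | one => exact ⟨0, 0, 1, one_mem _, by simp⟩
  | mul_left x hx y _ ih =>
    rcases hx with rfl | rfl
    · exact hmuls _ ih
    · exact hmulr _ ih
  | inv_mul_cancel x hx y _ ih =>
    rcases hx with rfl | rfl
    · rw [hsinv, mul_assoc, mul_assoc]
      exact hmuls _ (hmuls _ (hmuls _ ih))
    · rw [hrinv, mul_assoc]
      exact hmulr _ (hmulr _ ih)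

/-- The two syllables map to unitriangular matrices with off-diagonal entry −1, so products preserve
this sign pattern; it prevents a nonempty word from becoming 1 after multiplication by the finitely
many r^i and s^j. -/
theorem positive_word {π : G →* SL2Z} (hπs : π s = S⁻¹)
    (hπr : π r = sl 0 (-1) 1 (-1) (by norm_num)) {W : G}
    (hW : W ∈ Submonoid.closure {s * r, s⁻¹ * r⁻¹}) :
    W = 1 ∨ ∃ a b c d h, π W = sl a b c d h ∧ 1 ≤ a ∧ b ≤ 0 ∧ c ≤ 0 ∧ 1 ≤ d ∧ b + c ≤ -1 := by
  have hR : π (s * r) = sl 1 (-1) 0 1 (by norm_num) := by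
    rw [map_mul, hπs, hπr, S_eq, sl_inv, sl_mul, sl_inj]; norm_num
  have hL : π (s⁻¹ * r⁻¹) = sl 1 0 (-1) 1 (by norm_num) := by
    rw [map_mul, map_inv, map_inv, hπs, hπr, S_eq, sl_inv, sl_inv, sl_inv, sl_mul, sl_inj]
    norm_num
  induction hW using Submonoid.closure_induction_left with
  | one => exact Or.inl rfl
  | mul_left x hx y _ ih =>
    right
    rcases ih with rfl | ⟨a, b, c, d, h, e, h1, h2, h3, h4, h5⟩
    · rcases hx with rfl | rfl
      · exact ⟨_, _, _, _, _, by rw [mul_one, hR], by norm_num⟩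
      · exact ⟨_, _, _, _, _, by rw [mul_one, hL], by norm_num⟩
    · rcases hx with rfl | rfl
      · exact ⟨_, _, _, _, _, by rw [map_mul, hR, e, sl_mul], by
          refine ⟨?_, ?_, ?_, ?_, ?_⟩ <;> linarith⟩
      · exact ⟨_, _, _, _, _, by rw [map_mul, hL, e, sl_mul], by
          refine ⟨?_, ?_, ?_, ?_, ?_⟩ <;> linarith⟩

/-- A homomorphism to the special linear group is injective if its source is generated by two
elements which satisfy the relations of their images. -/
theorem eq_one_of_relations (hgen : Subgroup.closure {s, r} = ⊤) (hs : s ^ 4 = 1) (hr : r ^ 3 = 1)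
    (hz : Commute (s ^ 2) r) {π : G →* SL2Z} (hπs : π s = S⁻¹)
    (hπr : π r = sl 0 (-1) 1 (-1) (by norm_num)) {g : G} (hg : π g = 1) : g = 1 := by
  obtain ⟨i, hi, j, hj, W, hW, rfl⟩ := exists_normalForm hgen hs hr hz g
  rw [map_mul, map_mul, map_pow, map_pow, hπs, hπr, S_eq, sl_inv] at hg
  rcases positive_word hπs hπr hW with rfl | ⟨a, b, c, d, h, e, h1, h2, h3, h4, h5⟩
  · rw [map_one] at hg
    interval_cases i <;> interval_cases j <;>
      simp [pow_succ, sl_mul, sl_one, sl_inj] at hg ⊢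
  · rw [e] at hg
    interval_cases i <;> interval_cases j <;>
      simp [pow_succ, sl_mul, sl_one, sl_inj] at hg <;> omega

end NormalForm

theorem inn_range_normal : inn.range.Normal :=
  ⟨by rintro _ ⟨w, rfl⟩ f; exact ⟨f.1 w, (conj_inn f w).symm⟩⟩

/-- An automorphism acting trivially on the abelianization is inner. -/
theorem exists_eq_inn {f : AutPlus} (hf : rhoPlus f = 1) : ∃ w, f = inn w := by
  have := inn_range_normal
  let q := QuotientGroup.mk' inn.range
  let π : AutPlus ⧸ inn.range →* SL2Z := QuotientGroup.lift inn.range rhoPlus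
    (by rintro _ ⟨w, rfl⟩; exact rhoPlus_inn w)
  have hπ : ∀ f, π (q f) = rhoPlus f := fun f => rfl
  have hq : ∀ w, q (inn w) = 1 := fun w => (QuotientGroup.eq_one_iff _).2 ⟨w, rfl⟩
  have hs4 : iota ^ 4 = 1 := by
    rw [show 4 = 2 * 2 from rfl, pow_mul, iota_sq, sigma_sq]
  -- The inverse of `iota` is taken so that the syllables of the normal form become unitriangular.
  have hgen : Subgroup.closure {q iota⁻¹, q zeta} = ⊤ := by
    rw [eq_top_iff, ← Subgroup.map_top_of_surjective q (QuotientGroup.mk'_surjective _),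
      ← genSubgroup_eq_top, genSubgroup, MonoidHom.map_closure, Subgroup.closure_le]
    rintro _ ⟨x, (rfl | rfl) | ⟨w, rfl⟩, rfl⟩
    · rw [SetLike.mem_coe, ← inv_mem_iff, ← map_inv]
      exact Subgroup.subset_closure (by simp)
    · exact Subgroup.subset_closure (by simp)
    · rw [hq]; exact one_mem _
  have hsig : q iota⁻¹ ^ 2 = q sigma := by
    rw [← map_pow, inv_pow, iota_sq, inv_eq_of_mul_eq_one_left (by rw [← pow_two, sigma_sq])]
  have := eq_one_of_relations (s := q iota⁻¹) (r := q zeta) (π := π) hgen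
    (by rw [← map_pow, inv_pow, hs4, inv_one, map_one])
    (by rw [← map_pow, zeta_pow_three, map_one])
    (by rw [hsig]; change q sigma * q zeta = q zeta * q sigma
        rw [← map_mul, sigma_mul_zeta, map_mul, map_mul, hq, one_mul])
    (by rw [hπ, map_inv, rhoPlus_iota]) (by rw [hπ, rhoPlus_zeta]) (g := q f) (by rw [hπ, hf])
  obtain ⟨w, hw⟩ := (QuotientGroup.eq_one_iff _).1 this
  exact ⟨w, hw.symm⟩

theorem exists_eq_inn_mul {f g : AutPlus} (h : rhoPlus f = rhoPlus g) : ∃ w, f = inn w * g := by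
  obtain ⟨w, hw⟩ := exists_eq_inn (f := f * g⁻¹) (by rw [map_mul, map_inv, h, mul_inv_cancel])
  exact ⟨w, by rw [← hw]; group⟩

theorem closure_S_zeta : Subgroup.closure {S, sl 0 (-1) 1 (-1) (by norm_num)} = ⊤ := by
  rw [eq_top_iff, ← _root_.SpecialLinearGroup.SL2Z_generators, Subgroup.closure_le]
  have hS : S ∈ Subgroup.closure {S, sl 0 (-1) 1 (-1) (by norm_num)} :=
    Subgroup.subset_closure (by simp)
  have hZ : sl 0 (-1) 1 (-1) (by norm_num) ∈
      Subgroup.closure {S, sl 0 (-1) 1 (-1) (by norm_num)} :=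
    Subgroup.subset_closure (by simp)
  rintro x (rfl | rfl)
  · exact hS
  · have : ModularGroup.T = (sl 0 (-1) 1 (-1) (by norm_num))⁻¹ * S := by
      rw [S_eq, sl_inv, sl_mul]
      apply Subtype.ext
      simp [ModularGroup.T, sl]
    rw [this]
    exact mul_mem (inv_mem hZ) hS

theorem rhoPlus_surjective : Function.Surjective rhoPlus := by
  rw [← MonoidHom.range_eq_top, eq_top_iff, ← closure_S_zeta, Subgroup.closure_le]
  rintro _ (rfl | rfl)
  · exact ⟨iota, rhoPlus_iota⟩
  · exact ⟨zeta, rhoPlus_zeta⟩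

end TorsionAutFTwo

namespace TorsionAutFTwo

open Matrix

/-! ### The commutator subgroup of the special linear group -/

/-- The matrix of `zeta`. -/
def Z : SL2Z := sl 0 (-1) 1 (-1) (by norm_num)

theorem rhoPlus_zeta_eq : rhoPlus zeta = Z := rhoPlus_zeta

theorem Z_eq : Z = (B * A) ^ (2 : ℤ) := BA_zpow_two.symm

theorem Z_pow_three : Z ^ 3 = 1 := by
  rw [← rhoPlus_zeta_eq, ← map_pow, zeta_pow_three, map_one]

theorem Z_ne_one : Z ≠ 1 := by
  rw [Z, sl_one, Ne, sl_inj]; norm_num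

/-- An identification of the free group with the commutator subgroup of the special linear
group. -/
def toSL : F2 →* SL2Z :=
  FreeGroup.lift ![sl 2 1 1 1 (by norm_num), sl 2 (-1) (-1) 1 (by norm_num)]

theorem toSL_u : toSL u = sl 2 1 1 1 (by norm_num) := by simp [toSL, u]

theorem toSL_v : toSL v = sl 2 (-1) (-1) 1 (by norm_num) := by simp [toSL, v]

/-- The attracting cones of the two generators. -/
def attracting (i : Fin 2) : Set SL2Z :=
  ![{g | 0 < g.1 1 0 ∧ g.1 1 0 ≤ g.1 0 0 ∨ g.1 0 0 ≤ g.1 1 0 ∧ g.1 1 0 < 0},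
    {g | 0 ≤ g.1 1 0 ∧ g.1 1 0 < -g.1 0 0 ∨ 0 ≤ -g.1 1 0 ∧ -g.1 1 0 < g.1 0 0}] i

/-- The repelling cones of the two generators. -/
def repelling (i : Fin 2) : Set SL2Z :=
  ![{g | 0 < -g.1 0 0 ∧ -g.1 0 0 ≤ g.1 1 0 ∨ 0 < g.1 0 0 ∧ g.1 0 0 ≤ -g.1 1 0},
    {g | 0 ≤ g.1 0 0 ∧ g.1 0 0 < g.1 1 0 ∨ g.1 1 0 < g.1 0 0 ∧ g.1 0 0 ≤ 0}] i

theorem sl_column_ne_zero {a b c d : ℤ} (h : a * d - b * c = 1) : a ≠ 0 ∨ c ≠ 0 := by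
  by_contra! hc
  rw [hc.1, hc.2] at h
  norm_num at h

/-- Ping-pong on first columns: the four cones, each stable under −1, partition the nonzero
directions. -/
theorem toSL_injective : Function.Injective toSL := by
  apply FreeGroup.injective_lift_of_ping_pong _ attracting repelling
  · intro i
    fin_cases i
    · exact ⟨sl 1 0 1 1 (by norm_num), Or.inl ⟨by simp [sl], by simp [sl]⟩⟩
    · exact ⟨1, by simp [attracting]⟩
  · intro i j hij
    rw [Function.onFun, Set.disjoint_left]
    intro g
    fin_cases i <;> fin_cases j <;> simp [attracting] at hij ⊢ <;> omega
  · intro i j hij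
    rw [Function.onFun, Set.disjoint_left]
    intro g
    fin_cases i <;> fin_cases j <;> simp [repelling] at hij ⊢ <;> omega
  · intro i j
    rw [Set.disjoint_left]
    intro g
    fin_cases i <;> fin_cases j <;> simp [attracting, repelling] <;> omega
  · rintro i _ ⟨g, hg, rfl⟩
    obtain ⟨a, b, c, d, h, rfl⟩ := sl_eta g
    have h0 := sl_column_ne_zero h
    fin_cases i <;> simp [repelling, attracting, sl_mul] at hg ⊢ <;> simp [sl] at hg ⊢ <;> omega
  · rintro i _ ⟨g, hg, rfl⟩
    obtain ⟨a, b, c, d, h, rfl⟩ := sl_eta g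
    have h0 := sl_column_ne_zero h
    fin_cases i <;> simp [repelling, attracting, sl_inv, sl_mul] at hg ⊢ <;>
      simp [sl] at hg ⊢ <;> omega

theorem mul_toSL_of_generators {g : SL2Z} {f : AutPlus} (hu : g * toSL u = toSL (f.1 u) * g)
    (hv : g * toSL v = toSL (f.1 v) * g) (w : F2) : g * toSL w = toSL (f.1 w) * g := by
  have : (MulAut.conj g).toMonoidHom.comp toSL = toSL.comp f.1.toMonoidHom := by
    apply F2_hom_ext
    · simp [hu]
    · simp [hv]
  have h2 : g * toSL w * g⁻¹ = toSL (f.1 w) := DFunLike.congr_fun this w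
  rw [← h2]; group

/-- Hence `toSL w * Z` acts on the embedded free group as `inn w * zeta` does on the free group. -/
theorem Z_mul_toSL (w : F2) : Z * toSL w = toSL (zeta.1 w) * Z := by
  apply mul_toSL_of_generators <;>
    simp [Z, toSL_u, toSL_v, sl_mul, sl_inv]

theorem S_mul_toSL (w : F2) : S * toSL w = toSL (sigma.1 w) * S := by
  apply mul_toSL_of_generators <;>
    simp [S_eq, toSL_u, toSL_v, sl_mul, sl_inv]

theorem Z_mul_S : Z * S = toSL v⁻¹ * S * Z := by
  simp [Z, S_eq, toSL_v, sl_mul, sl_inv]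

/-- Modulo the embedded free group on the left and the centralizer of `Z` on the right, a conjugator
is 1 or S. These two families are stable under left multiplication by the generators S and `Z`. -/
theorem exists_coset (h : SL2Z) :
    ∃ x c, Commute c Z ∧ (h = toSL x * c ∨ h = toSL x * S * c) := by
  have hS : ∀ h : SL2Z, (∃ x c, Commute c Z ∧ (h = toSL x * c ∨ h = toSL x * S * c)) →
      ∃ x c, Commute c Z ∧ (S * h = toSL x * c ∨ S * h = toSL x * S * c) := by
    rintro _ ⟨x, c, hc, rfl | rfl⟩
    · exact ⟨_, c, hc, Or.inr (by rw [← mul_assoc, S_mul_toSL])⟩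
    · refine ⟨sigma.1 x, S * S * c, ?_, Or.inl (by
        rw [← mul_assoc, ← mul_assoc, S_mul_toSL]; simp only [mul_assoc])⟩
      have : S * S = -1 := by rw [S_eq, sl_mul, sl_one, sl_neg, sl_inj]; norm_num
      rw [this]
      exact Commute.mul_left (by simp) hc
  have hZ : ∀ h : SL2Z, (∃ x c, Commute c Z ∧ (h = toSL x * c ∨ h = toSL x * S * c)) →
      ∃ x c, Commute c Z ∧ (Z * h = toSL x * c ∨ Z * h = toSL x * S * c) := by
    rintro _ ⟨x, c, hc, rfl | rfl⟩
    · exact ⟨_, Z * c, (Commute.refl Z).mul_left hc, Or.inl (by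
        rw [← mul_assoc, Z_mul_toSL, mul_assoc])⟩
    · refine ⟨zeta.1 x * v⁻¹, Z * c, (Commute.refl Z).mul_left hc, Or.inr ?_⟩
      rw [← mul_assoc, ← mul_assoc, Z_mul_toSL, mul_assoc _ Z S, Z_mul_S, map_mul]
      simp only [mul_assoc]
  have hg : h ∈ Subgroup.closure {S, Z} := by rw [Z, closure_S_zeta]; trivial
  have hZi : Z⁻¹ = Z * Z := by rw [inv_eq_iff_mul_eq_one, ← Z_pow_three, pow_succ', pow_two]
  have hSi : S⁻¹ = S * (S * S) := by
    rw [S_eq, sl_inv, sl_mul, sl_mul, sl_inj]; norm_num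
  induction hg using Subgroup.closure_induction_left with
  | one => exact ⟨1, 1, Commute.one_left _, Or.inl (by simp)⟩
  | mul_left x hx y _ ih =>
    rcases hx with rfl | rfl
    · exact hS _ ih
    · exact hZ _ ih
  | inv_mul_cancel x hx y _ ih =>
    rcases hx with rfl | rfl
    · rw [hSi, mul_assoc, mul_assoc]
      exact hS _ (hS _ (hS _ ih))
    · rw [hZi, mul_assoc]
      exact hZ _ (hZ _ ih)

theorem F2_eq_one_of_pow {w : F2} {n : ℕ} (hn : n ≠ 0) (h : w ^ n = 1) : w = 1 :=
  pow_left_injective hn (by simpa using h)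

/-- For central w, `toSL w` commutes with two matrices whose common centralizer is ±1, so w² = 1,
and the free group is torsion-free. -/
theorem inn_injective : Function.Injective inn := by
  rw [injective_iff_map_eq_one]
  intro w hw
  have hu : w * u * w⁻¹ = u := by rw [← inn_apply, hw]; rfl
  have hv : w * v * w⁻¹ = v := by rw [← inn_apply, hw]; rfl
  have hu' := congrArg toSL (mul_inv_eq_iff_eq_mul.1 hu)
  have hv' := congrArg toSL (mul_inv_eq_iff_eq_mul.1 hv)
  apply F2_eq_one_of_pow two_ne_zero
  apply toSL_injective
  rw [map_pow, map_one]
  obtain ⟨a, b, c, d, h, e⟩ := sl_eta (toSL w)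
  rw [map_mul, map_mul, e, toSL_u, sl_mul, sl_mul, sl_inj] at hu'
  rw [map_mul, map_mul, e, toSL_v, sl_mul, sl_mul, sl_inj] at hv'
  obtain rfl : b = c := by linarith [hu'.1]
  obtain rfl : b = 0 := by linarith [hu'.2.1, hv'.2.1]
  obtain rfl : a = d := by linarith [hu'.2.1]
  have ha : a * a = 1 := by linarith
  rw [e, pow_two, sl_mul, sl_one, sl_inj]
  refine ⟨?_, ?_, ?_, ?_⟩ <;> linarith

end TorsionAutFTwo

namespace TorsionAutFTwo

open Matrix

/-! ### Lifts of order two -/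

/-- The formal inverse of a letter. -/
def flip (l : Fin 2 × Bool) : Fin 2 × Bool := (l.1, !l.2)

theorem flip_injective : Function.Injective flip := by
  rintro ⟨i, b⟩ ⟨j, c⟩ h
  simpa [flip] using h

theorem sigma_letter (l : Fin 2 × Bool) : sigma.1 (letter l) = letter (flip l) := by
  rw [flip, ← letter_inv]
  rcases letter_eq l with e | e | e | e <;> simp [e]

theorem sigma_mk (L : List (Fin 2 × Bool)) :
    sigma.1 (FreeGroup.mk L) = FreeGroup.mk (L.map flip) := by
  induction L with
  | nil => exact map_one _
  | cons l L ih => rw [letter_mul_mk, map_mul, sigma_letter, ih, List.map_cons, letter_mul_mk]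

theorem toWord_sigma (w : F2) : (sigma.1 w).toWord = w.toWord.map flip := by
  have h : FreeGroup.IsReduced (w.toWord.map flip) := by
    rw [FreeGroup.IsReduced, List.isChain_map]
    refine List.IsChain.imp ?_ (FreeGroup.isReduced_toWord (x := w))
    intro a b hab h
    simp only [flip] at h ⊢
    rw [hab h]
  conv_lhs => rw [← FreeGroup.mk_toWord (x := w), sigma_mk, FreeGroup.toWord_mk, h.reduce_eq]

theorem eq_one_of_sigma_fixed {w : F2} (h : sigma.1 w = w) : w = 1 := by
  have h2 := toWord_sigma w
  rw [h] at h2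
  rcases hL : w.toWord with _ | ⟨l, L⟩
  · exact FreeGroup.toWord_eq_nil_iff.1 hL
  · rw [hL, List.map_cons, List.cons.injEq] at h2
    simpa [flip] using congrArg Prod.snd h2.1

/-- `sigma` flips each letter in place, while inversion also reverses the word. -/
theorem palindrome_of_sigma_inv {w : F2} (h : sigma.1 w = w⁻¹) : w.toWord.Palindrome := by
  have h2 := toWord_sigma w
  rw [h, FreeGroup.toWord_inv, FreeGroup.invRev] at h2
  change (w.toWord.map flip).reverse = _ at h2
  rw [← List.map_reverse] at h2
  exact List.Palindrome.of_reverse_eq (List.map_injective_iff.2 flip_injective h2)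

theorem palindrome_decomposition {L : List (Fin 2 × Bool)} (h : L.Palindrome) :
    ∃ y c : F2, (c = 1 ∨ ∃ l, c = letter l) ∧ FreeGroup.mk L = y * c * (sigma.1 y)⁻¹ := by
  induction h with
  | nil => exact ⟨1, 1, Or.inl rfl, by simp; rfl⟩
  | singleton l => exact ⟨1, letter l, Or.inr ⟨l, rfl⟩, by simp [letter]⟩
  | @cons_concat l L _ ih =>
    obtain ⟨y, c, hc, e⟩ := ih
    -- As l = σ(l)⁻¹, adding l at both ends is a twisted conjugation.
    refine ⟨letter l * y, c, hc, ?_⟩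
    rw [letter_mul_mk, ← FreeGroup.mul_mk, e, map_mul, sigma_letter, flip, ← letter_inv,
      _root_.mul_inv_rev, inv_inv]
    simp only [mul_assoc, letter]

/-- Normal form of the elements inverted by `sigma`, up to twisted conjugation. -/
theorem exists_eq_of_sigma_inv {w : F2} (h : sigma.1 w = w⁻¹) :
    ∃ y c : F2, (c = 1 ∨ c = u ∨ c = v) ∧ w = y * c * (sigma.1 y)⁻¹ := by
  obtain ⟨y, c, hc, e⟩ := palindrome_decomposition (palindrome_of_sigma_inv h)
  rw [FreeGroup.mk_toWord] at e
  rcases hc with rfl | ⟨l, rfl⟩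
  · exact ⟨y, 1, Or.inl rfl, e⟩
  · rcases letter_eq l with hl | hl | hl | hl <;> rw [hl] at e
    · exact ⟨y, u, Or.inr (Or.inl rfl), e⟩
    · exact ⟨y * u⁻¹, u, Or.inr (Or.inl rfl), by simp [e, mul_assoc]⟩
    · exact ⟨y, v, Or.inr (Or.inr rfl), e⟩
    · exact ⟨y * v⁻¹, v, Or.inr (Or.inr rfl), by simp [e, mul_assoc]⟩

theorem inn_mul_twisted (f : AutPlus) (y c : F2) :
    inn (y * c * (f.1 y)⁻¹) * f = inn y * (inn c * f) * (inn y)⁻¹ := by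
  rw [eq_mul_inv_iff_mul_eq, mul_assoc, mul_inn, map_mul, map_mul, map_inv]
  group

theorem inn_mul_mul_inn_mul (f g : AutPlus) (x y : F2) :
    inn x * f * (inn y * g) = inn (x * f.1 y) * (f * g) := by
  rw [map_mul, ← mul_assoc, mul_assoc (inn x), mul_inn]
  simp only [mul_assoc]

theorem inn_mul_inj {f : AutPlus} {x y : F2} : inn x * f = inn y * f ↔ x = y := by
  rw [mul_left_inj, inn_injective.eq_iff]

theorem sigma_inv_of_sq {w : F2} (h : (inn w * sigma) ^ 2 = 1) : sigma.1 w = w⁻¹ := by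
  rw [pow_two, inn_mul_mul_inn_mul, ← pow_two, sigma_sq, mul_one, ← map_one inn,
    inn_injective.eq_iff] at h
  exact (inv_eq_of_mul_eq_one_right h).symm

theorem isConj_inn_u_sigma : IsConj (inn u * sigma) sigma := by
  apply IsConj.symm
  apply isConj_of_mul_eq (iota * tau * iota⁻¹)
  apply AutPlus_ext <;> simp [mul_assoc]

theorem isConj_inn_v_sigma : IsConj (inn v * sigma) sigma := by
  apply IsConj.symm
  apply isConj_of_mul_eq tau⁻¹
  apply AutPlus_ext <;> simp [mul_assoc]

theorem isConj_sigma {γ : AutPlus} (h : rhoPlus γ = -1) (h2 : γ ^ 2 = 1) : IsConj γ sigma := by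
  obtain ⟨w, rfl⟩ := exists_eq_inn_mul (h.trans rhoPlus_sigma.symm)
  obtain ⟨y, c, hc, rfl⟩ := exists_eq_of_sigma_inv (sigma_inv_of_sq h2)
  rw [inn_mul_twisted]
  refine IsConj.trans (IsConj.symm (isConj_iff.2 ⟨inn y, rfl⟩)) ?_
  rcases hc with rfl | rfl | rfl
  · rw [map_one, one_mul]
  · exact isConj_inn_u_sigma
  · exact isConj_inn_v_sigma

/-! ### Lifts of orders four and six -/

/-- The exponent sum of a generator in an element of the free group. -/
def expSum (i : Fin 2) (w : F2) : ℤ := (ab w).toAdd i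

theorem expSum_mul (i : Fin 2) (x y : F2) : expSum i (x * y) = expSum i x + expSum i y := by
  simp [expSum]

theorem expSum_inv (i : Fin 2) (x : F2) : expSum i x⁻¹ = -expSum i x := by
  simp [expSum]

theorem expSum_map (f : AutPlus) (i : Fin 2) (w : F2) :
    expSum i (f.1 w) = rhoMatrix f.1 i 0 * expSum 0 w + rhoMatrix f.1 i 1 * expSum 1 w := by
  have h := congrFun (ab_apply f.1.toMonoidHom w) i
  simp only [Matrix.mulVec, dotProduct, Fin.sum_univ_two] at h
  exact h

theorem expSum_sigma (i : Fin 2) (w : F2) : expSum i (sigma.1 w) = -expSum i w := by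
  have e : rhoMatrix sigma.1 = !![-1, 0; 0, -1] := rhoMatrix_sigmaAut
  rw [expSum_map, e]
  fin_cases i <;> simp

theorem expSum_iota_zero (w : F2) : expSum 0 (iota.1 w) = -expSum 1 w := by
  have e : rhoMatrix iota.1 = !![0, -1; 1, 0] := rhoMatrix_iotaAut
  rw [expSum_map, e]
  simp

theorem expSum_iota_one (w : F2) : expSum 1 (iota.1 w) = expSum 0 w := by
  have e : rhoMatrix iota.1 = !![0, -1; 1, 0] := rhoMatrix_iotaAut
  rw [expSum_map, e]
  simp

theorem expSum_zeta_zero (w : F2) : expSum 0 (zeta.1 w) = -expSum 1 w := by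
  have e : rhoMatrix zeta.1 = !![0, -1; 1, -1] := rhoMatrix_zetaAut
  rw [expSum_map, e]
  simp

theorem expSum_zeta_one (w : F2) : expSum 1 (zeta.1 w) = expSum 0 w - expSum 1 w := by
  have e : rhoMatrix zeta.1 = !![0, -1; 1, -1] := rhoMatrix_zetaAut
  rw [expSum_map, e]
  simp [sub_eq_add_neg]

@[simp] theorem expSum_zero_u : expSum 0 u = 1 := by simp [expSum]
@[simp] theorem expSum_one_u : expSum 1 u = 0 := by simp [expSum]
@[simp] theorem expSum_zero_v : expSum 0 v = 0 := by simp [expSum]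
@[simp] theorem expSum_one_v : expSum 1 v = 1 := by simp [expSum]
@[simp] theorem expSum_one (i : Fin 2) : expSum i 1 = 0 := by simp [expSum]

theorem expSum_twisted (i : Fin 2) (y c : F2) :
    expSum i (y * c * (sigma.1 y)⁻¹) = 2 * expSum i y + expSum i c := by
  rw [expSum_mul, expSum_mul, expSum_inv, expSum_sigma]
  ring

theorem isConj_lift {γ : AutPlus} {g : SL2Z} (h : IsConj (rhoPlus γ) g) :
    ∃ γ', IsConj γ γ' ∧ rhoPlus γ' = g := by
  obtain ⟨c, rfl⟩ := isConj_iff.1 h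
  obtain ⟨f, rfl⟩ := rhoPlus_surjective c
  exact ⟨f * γ * f⁻¹, isConj_iff.2 ⟨f, rfl⟩, by simp⟩

theorem isConj_inv {G : Type*} [Group G] {x y : G} (h : IsConj x y) : IsConj x⁻¹ y⁻¹ := by
  obtain ⟨c, rfl⟩ := isConj_iff.1 h
  exact isConj_iff.2 ⟨c, by group⟩

theorem pow_eq_one_of_isConj {G : Type*} [Group G] {x y : G} (h : IsConj x y) {n : ℕ}
    (hx : x ^ n = 1) : y ^ n = 1 := by
  rw [← orderOf_dvd_iff_pow_eq_one, ← orderOf_eq_of_isConj h]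
  exact orderOf_dvd_of_pow_eq_one hx

theorem isConj_iota {γ : AutPlus} (h : IsConj (rhoPlus γ) S) (h4 : γ ^ 4 = 1) :
    IsConj γ iota := by
  obtain ⟨γ, hγ, e⟩ := isConj_lift h
  refine hγ.trans ?_
  replace h4 := pow_eq_one_of_isConj hγ h4
  obtain ⟨w, rfl⟩ := exists_eq_inn_mul (e.trans rhoPlus_iota.symm)
  have hsq : (inn w * iota) ^ 2 = inn (w * iota.1 w) * sigma := by
    rw [pow_two, inn_mul_mul_inn_mul, ← pow_two, iota_sq]
  have hs := sigma_inv_of_sq (w := w * iota.1 w) (by rw [← hsq, ← pow_mul]; exact h4)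
  obtain ⟨y, c, hc, ey⟩ := exists_eq_of_sigma_inv hs
  have e0 := congrArg (expSum 0) ey
  have e1 := congrArg (expSum 1) ey
  rw [expSum_twisted, expSum_mul] at e0 e1
  rw [expSum_iota_zero] at e0
  rw [expSum_iota_one] at e1
  -- The exponent sums of w ι(w) are a − b and a + b, of equal parity; c = u or c = v would make the
  -- parities differ.
  have hc1 : c = 1 := by
    rcases hc with rfl | rfl | rfl
    · rfl
    · simp only [expSum_zero_u, expSum_one_u] at e0 e1; omega
    · simp only [expSum_zero_v, expSum_one_v] at e0 e1; omega
  subst hc1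
  rw [ey, inn_mul_twisted, map_one, one_mul] at hsq
  obtain ⟨δ, hδ⟩ : ∃ δ, δ = (inn y)⁻¹ * (inn w * iota) * inn y := ⟨_, rfl⟩
  have hδ2 : δ ^ 2 = sigma := by
    have : δ ^ 2 = (inn y)⁻¹ * (inn w * iota) ^ 2 * inn y := by
      rw [hδ, pow_two, pow_two]; group
    rw [this, hsq]; group
  have hδr : rhoPlus δ = rhoPlus iota := by
    rw [hδ, map_mul, map_mul, map_mul, map_inv, rhoPlus_inn, rhoPlus_inn]
    simp
  obtain ⟨x, hx⟩ := exists_eq_inn_mul hδr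
  have hcomm : sigma * δ = δ * sigma := by rw [← hδ2, pow_two, mul_assoc]
  -- Commuting with its own square `sigma` makes x a fixed point of `sigma`.
  have hx1 : x = 1 := by
    apply eq_one_of_sigma_fixed
    rw [hx, ← mul_assoc, mul_inn, mul_assoc, mul_assoc, ← iota_sq, ← pow_succ, ← pow_succ',
      inn_mul_inj] at hcomm
    rw [← iota_sq]
    exact hcomm
  refine isConj_iff.2 ⟨(inn y)⁻¹, ?_⟩
  rw [inv_inv, ← hδ, hx, hx1, map_one, one_mul]

/-- Commutation reads w σ(x) v = x ζ(w). Modulo two it makes both exponent sums of w odd, whereas w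
is a twisted conjugate of 1, u or v. -/
theorem not_commute_of_lifts {α β : AutPlus} (hα : rhoPlus α = -1) (hα2 : α ^ 2 = 1)
    (hβ : rhoPlus β = rhoPlus zeta) : ¬ Commute α β := by
  intro hc
  obtain ⟨w, rfl⟩ := exists_eq_inn_mul (hα.trans rhoPlus_sigma.symm)
  obtain ⟨x, rfl⟩ := exists_eq_inn_mul hβ
  replace hc := hc.eq
  rw [inn_mul_mul_inn_mul, inn_mul_mul_inn_mul, sigma_mul_zeta, mul_assoc, ← mul_assoc,
    ← map_mul, inn_mul_inj] at hc
  obtain ⟨y, c, hc', rfl⟩ := exists_eq_of_sigma_inv (sigma_inv_of_sq hα2)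
  have e0 := congrArg (expSum 0) hc
  have e1 := congrArg (expSum 1) hc
  simp only [expSum_mul _ x, expSum_mul _ _ v, expSum_mul _ _ (sigma.1 x), expSum_zeta_zero,
    expSum_zeta_one, expSum_sigma _ x, expSum_twisted, expSum_zero_v, expSum_one_v] at e0 e1
  rcases hc' with rfl | rfl | rfl <;>
    simp only [expSum_zero_v, expSum_one_v, expSum_zero_u, expSum_one_u, expSum_one] at e0 e1 <;>
    omega

/-- The kernel is the image of the torsion-free group `F2` under the injective map `inn`. -/
theorem orderOf_rhoPlus {γ : AutPlus} (h : IsOfFinOrder γ) :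
    orderOf (rhoPlus γ) = orderOf γ := by
  apply Nat.dvd_antisymm (orderOf_map_dvd _ _)
  apply orderOf_dvd_of_pow_eq_one
  obtain ⟨w, hw⟩ := exists_eq_inn (f := γ ^ orderOf (rhoPlus γ))
    (by rw [map_pow, pow_orderOf_eq_one])
  have hw2 : inn (w ^ orderOf γ) = 1 := by
    rw [map_pow, ← hw, ← pow_mul, mul_comm, pow_mul, pow_orderOf_eq_one, one_pow]
  have hw3 : w = 1 := F2_eq_one_of_pow (orderOf_pos_iff.2 h).ne'
    (inn_injective (by rw [hw2, map_one]))
  rw [hw, hw3, map_one]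

theorem not_isConj_rhoPlus_BA {γ : AutPlus} (h6 : γ ^ 6 = 1) :
    ¬ IsConj (rhoPlus γ) (B * A) := by
  intro h
  obtain ⟨γ, hγ, e⟩ := isConj_lift h
  replace h6 := pow_eq_one_of_isConj hγ h6
  refine not_commute_of_lifts (α := γ ^ 3) (β := γ ^ 2) ?_ ?_ ?_
    ((Commute.refl γ).pow_pow 3 2)
  · rw [map_pow, e, BA_pow_three]
  · rw [← pow_mul]; exact h6
  · rw [map_pow, e, rhoPlus_zeta_eq, Z_eq, zpow_ofNat]

theorem orderOf_ne_six (γ : AutPlus) : orderOf γ ≠ 6 := by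
  intro h
  have ho : IsOfFinOrder γ := orderOf_pos_iff.1 (by omega)
  have h6 : γ ^ 6 = 1 := by rw [← h, pow_orderOf_eq_one]
  rcases SL2Z_orderOf_eq_six.1 ((orderOf_rhoPlus ho).trans h) with hc | hc
  · exact not_isConj_rhoPlus_BA h6 hc
  · refine not_isConj_rhoPlus_BA (γ := γ⁻¹) (by rw [inv_pow, h6, inv_one]) ?_
    rw [map_inv, ← inv_inv (B * A)]
    exact isConj_inv hc

/-! ### Lifts of order three -/

theorem S_mul_Z : S * Z = toSL v * Z * S := by
  rw [mul_assoc, Z_mul_S, ← mul_assoc, ← mul_assoc, ← map_mul, mul_inv_cancel, map_one, one_mul]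

theorem Z_sq_ne_one : Z ^ 2 ≠ 1 := by
  intro h
  have := Z_pow_three
  rw [pow_succ, h, one_mul] at this
  exact Z_ne_one this

theorem isConj_inn_v_zeta : IsConj (inn v * zeta) zeta := by
  apply IsConj.symm
  exact isConj_of_mul_eq sigma sigma_mul_zeta

/-- No conjugate of `Z ^ 2` lies in the image of the free group. -/
theorem not_conj_Z_sq_mem (g : SL2Z) (y : F2) : g * Z ^ 2 * g⁻¹ ≠ toSL y := by
  intro h
  have h3 : y ^ 3 = 1 := by
    apply toSL_injective
    rw [map_pow, ← h, conj_pow, ← pow_mul, mul_comm, pow_mul, Z_pow_three]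
    simp
  rw [F2_eq_one_of_pow three_ne_zero h3, map_one, mul_inv_eq_one] at h
  exact Z_sq_ne_one (by simpa using h)

/-- The element `toSL w * Z` has order three, so it is conjugate to `Z` or `Z⁻¹`. In the first case,
decomposing the conjugator by `exists_coset` exhibits w as a twisted conjugate of 1 or v, and
`sigma` conjugates `zeta` to `inn v * zeta`. -/
theorem isConj_zeta {γ : AutPlus} (h : IsConj (rhoPlus γ) Z) (h3 : γ ^ 3 = 1) :
    IsConj γ zeta := by
  obtain ⟨γ, hγ, e⟩ := isConj_lift h
  refine hγ.trans ?_
  replace h3 := pow_eq_one_of_isConj hγ h3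
  obtain ⟨w, rfl⟩ := exists_eq_inn_mul (e.trans rhoPlus_zeta_eq.symm)
  have hw : w * zeta.1 w * zeta.1 (zeta.1 w) = 1 := by
    rw [pow_succ, pow_two, inn_mul_mul_inn_mul, inn_mul_mul_inn_mul, ← pow_two, ← pow_succ,
      zeta_pow_three, mul_one, ← map_one inn, inn_injective.eq_iff] at h3
    exact h3
  have hg3 : (toSL w * Z) ^ 3 = 1 := by
    calc (toSL w * Z) ^ 3 = toSL w * (Z * toSL w) * (Z * toSL w) * Z := by
          rw [pow_succ, pow_two]; group
      _ = toSL w * toSL (zeta.1 w) * Z * toSL (zeta.1 w) * Z * Z := by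
          rw [Z_mul_toSL]; simp only [mul_assoc]
      _ = toSL w * toSL (zeta.1 w) * (Z * toSL (zeta.1 w)) * Z * Z := by simp only [mul_assoc]
      _ = toSL (w * zeta.1 w * zeta.1 (zeta.1 w)) * Z ^ 3 := by
          rw [Z_mul_toSL, map_mul, map_mul, pow_succ, pow_two]; simp only [mul_assoc]
      _ = 1 := by rw [hw, Z_pow_three, map_one, one_mul]
  have hg1 : toSL w * Z ≠ 1 := by
    intro h
    apply not_conj_Z_sq_mem 1 (w⁻¹ * w⁻¹)
    rw [map_mul, map_inv, inv_eq_of_mul_eq_one_right h, pow_two]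
    simp
  have horder : orderOf (toSL w * Z) = 3 := orderOf_eq_prime hg3 hg1
  rcases SL2Z_orderOf_eq_three.1 horder with hc | hc
  · rw [← Z_eq] at hc
    obtain ⟨g, hg⟩ := isConj_iff.1 hc.symm
    rw [mul_inv_eq_iff_eq_mul] at hg
    obtain ⟨x, c, hcz, rfl | rfl⟩ := exists_coset g
    · have h1 : w = x * 1 * (zeta.1 x)⁻¹ := by
        rw [mul_assoc, hcz.eq, ← mul_assoc, ← mul_assoc, mul_left_inj, mul_assoc _ Z, Z_mul_toSL,
          ← mul_assoc, mul_left_inj, ← map_mul, toSL_injective.eq_iff] at hg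
        rw [eq_mul_inv_iff_mul_eq, mul_one]
        exact hg.symm
      rw [h1, inn_mul_twisted, map_one, one_mul]
      exact IsConj.symm (isConj_iff.2 ⟨inn x, rfl⟩)
    · have h1 : w = x * v * (zeta.1 x)⁻¹ := by
        rw [mul_assoc, hcz.eq, ← mul_assoc, ← mul_assoc, mul_left_inj, ← mul_assoc, mul_assoc _ Z,
          Z_mul_toSL, mul_assoc _ S, S_mul_Z, ← mul_assoc, ← mul_assoc, mul_left_inj, ← mul_assoc,
          mul_left_inj, ← map_mul, ← map_mul, toSL_injective.eq_iff] at hg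
        rw [eq_mul_inv_iff_mul_eq, hg]
      rw [h1, inn_mul_twisted]
      exact IsConj.trans (IsConj.symm (isConj_iff.2 ⟨inn x, rfl⟩)) isConj_inn_v_zeta
  -- Conjugacy to `Z⁻¹` would put a conjugate of `Z ^ 2`, an element of order three, into the
  -- embedded free group.
  · exfalso
    rw [_root_.zpow_neg, ← Z_eq] at hc
    obtain ⟨g, hg⟩ := isConj_iff.1 hc.symm
    rw [mul_inv_eq_iff_eq_mul] at hg
    obtain ⟨x, c, hcz, rfl | rfl⟩ := exists_coset g
    · rw [mul_assoc, hcz.inv_right.eq, ← mul_assoc, ← mul_assoc, mul_left_inj, mul_assoc _ Z,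
        Z_mul_toSL, ← mul_assoc, ← map_mul] at hg
      apply not_conj_Z_sq_mem 1 ((w * zeta.1 x)⁻¹ * x)
      rw [map_mul, map_inv, mul_inv_eq_iff_eq_mul.1 hg, pow_two]
      group
    · rw [mul_assoc, hcz.inv_right.eq, ← mul_assoc, ← mul_assoc, mul_left_inj, ← mul_assoc,
        mul_assoc _ Z, Z_mul_toSL, ← mul_assoc, mul_assoc _ Z, Z_mul_S, ← mul_assoc, ← mul_assoc,
        ← map_mul, ← map_mul] at hg
      apply not_conj_Z_sq_mem S ((w * zeta.1 x * v⁻¹)⁻¹ * x)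
      have h1 : toSL x = toSL (w * zeta.1 x * v⁻¹) * S * Z * Z * S⁻¹ := by
        rw [← hg]; group
      rw [map_mul, map_inv, h1, pow_two]
      group

end TorsionAutFTwo

open TorsionAutFTwo in
theorem mainTheorem5 :
    -- torsion of the special linear group: possible orders of nontrivial torsion elements
    ({n : ℕ | ∃ g : SL2Z, g ≠ 1 ∧ IsOfFinOrder g ∧ orderOf g = n} = {6, 4, 3, 2}) ∧
    -- two conjugacy classes of elements of order six
    ((∀ g : SL2Z, orderOf g = 6 ↔ IsConj g (B * A) ∨ IsConj g (B * A)⁻¹) ∧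
      ¬ IsConj (B * A) (B * A)⁻¹) ∧
    -- two conjugacy classes of elements of order four
    ((∀ g : SL2Z, orderOf g = 4 ↔ IsConj g S ∨ IsConj g S⁻¹) ∧ ¬ IsConj S S⁻¹) ∧
    -- two conjugacy classes of elements of order three
    ((∀ g : SL2Z, orderOf g = 3 ↔
        IsConj g ((B * A) ^ (2 : ℤ)) ∨ IsConj g ((B * A) ^ (-2 : ℤ))) ∧
      ¬ IsConj ((B * A) ^ (2 : ℤ)) ((B * A) ^ (-2 : ℤ))) ∧
    -- one conjugacy class of elements of order two
    (∀ g : SL2Z, orderOf g = 2 ↔ IsConj g (-1)) ∧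
    -- the explicit matrices of the representatives
    (((B * A : SL2Z) : Matrix (Fin 2) (Fin 2) ℤ) = !![1, -1; 1, 0] ∧
      (((B * A)⁻¹ : SL2Z) : Matrix (Fin 2) (Fin 2) ℤ) = !![0, 1; -1, 1] ∧
      (((B * A) ^ (2 : ℤ) : SL2Z) : Matrix (Fin 2) (Fin 2) ℤ) = !![0, -1; 1, -1] ∧
      (((B * A) ^ (-2 : ℤ) : SL2Z) : Matrix (Fin 2) (Fin 2) ℤ) = !![-1, 1; -1, 0]) ∧
    -- lifts with the same order of elements of order two, four, three
    (∀ g : SL2Z, orderOf g = 2 → ∀ γ : AutPlus, rhoPlus γ = g → orderOf γ = orderOf g →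
      IsConj γ sigma) ∧
    (∀ g : SL2Z, orderOf g = 4 → ∀ γ : AutPlus, rhoPlus γ = g → orderOf γ = orderOf g →
      IsConj γ iota ∨ IsConj γ iota⁻¹) ∧
    (∀ g : SL2Z, orderOf g = 3 → ∀ γ : AutPlus, rhoPlus γ = g → orderOf γ = orderOf g →
      IsConj γ zeta ∨ IsConj γ zeta⁻¹) ∧
    -- no direct automorphism has order six
    (∀ γ : AutPlus, orderOf γ ≠ 6) := by
  refine ⟨SL2Z_torsion_orders, ⟨fun g => SL2Z_orderOf_eq_six, not_isConj_BA_inv⟩,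
    ⟨fun g => SL2Z_orderOf_eq_four, not_isConj_S_inv⟩,
    ⟨fun g => SL2Z_orderOf_eq_three, not_isConj_BA_zpow_two⟩, fun g => SL2Z_orderOf_eq_two,
    ⟨?_, ?_, ?_, ?_⟩, ?_, ?_, ?_, orderOf_ne_six⟩
  · rw [BA_eq]; rfl
  · rw [BA_eq, sl_inv]; simp [sl]
  · rw [BA_zpow_two]; rfl
  · rw [BA_zpow_neg_two]; rfl
  · rintro _ hg γ rfl hγ
    rw [hg] at hγ
    refine isConj_sigma ?_ (orderOf_dvd_iff_pow_eq_one.1 hγ.dvd)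
    obtain ⟨c, hc⟩ := isConj_iff.1 (SL2Z_orderOf_eq_two.1 hg).symm
    rw [← hc]
    simp
  · rintro _ hg γ rfl hγ
    rw [hg] at hγ
    have h4 : γ ^ 4 = 1 := orderOf_dvd_iff_pow_eq_one.1 hγ.dvd
    rcases SL2Z_orderOf_eq_four.1 hg with hc | hc
    · exact Or.inl (isConj_iota hc h4)
    -- The inverse class reduces to the previous case by passing to γ⁻¹.
    · right
      have := isConj_iota (γ := γ⁻¹) (by rw [map_inv, ← inv_inv S]; exact isConj_inv hc)
        (by rw [inv_pow, h4, inv_one])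
      rw [← inv_inv γ]
      exact isConj_inv this
  · rintro _ hg γ rfl hγ
    rw [hg] at hγ
    have h3 : γ ^ 3 = 1 := orderOf_dvd_iff_pow_eq_one.1 hγ.dvd
    rcases SL2Z_orderOf_eq_three.1 hg with hc | hc
    · exact Or.inl (isConj_zeta (by rw [Z_eq]; exact hc) h3)
    · right
      rw [zpow_neg, ← Z_eq] at hc
      have := isConj_zeta (γ := γ⁻¹) (by rw [map_inv, ← inv_inv Z]; exact isConj_inv hc)
        (by rw [inv_pow, h3, inv_one])
      rw [← inv_inv γ]
      exact isConj_inv this
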